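/- **Notation.** Let $\mathcal U$ be a triangulated category with all small coproducts. For a class $P$ of objects, $[P\rangle$ denotes the smallest class of objects of $\mathcal U$ that contains $P$ and $0$ and is closed under extensions and small coproducts. An object $X$ is compact if $\mathcal U(X,-)$ respects coproducts; an object $G$ compactly generates $\mathcal U$ (is a compact generator) if $G$ is compact and $[\bigcup_{i\in\mathbb Z}G[i]\rangle=\operatorname{Obj}\mathcal U$. An object $G$ is weakly negative if $\mathcal U(G,G[i])=0$ for all $i>1$. For classes $X,Y$ let $X\star Y$ be the class of all $C$ that fit into a distinguished triangle $A\to C\to B\to A[1]$ with $A\in X$, $B\in Y$. For integers $a\le b$ let $G[a,b]=\{G[-i]: a\le i\le b\}$. Let $\operatorname{Coprod}_1(G[a,b])$ be the class of all small coproducts of elements of $G[a,b]$ and $\operatorname{Coprod}_{n+1}=\operatorname{Coprod}_1\star\operatorname{Coprod}_n$. Let $\overline{\langle G\rangle}{}^{[a,b]}_n$ be the class of retracts of elements of $\operatorname{Coprod}_n(G[a,b])$, and $\overline{\langle G\rangle}{}^{[a,b]}$ the class of retracts of elements of $[G[a,b]\rangle$. $\mathcal U$ is *weakly approximable* if there exist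 a compact generator $G$, a $t$-structure $t$ on $\mathcal U$ and an integer $A>0$ such that $G[A]\in\mathcal U^{t\le 0}$, $\mathcal U(G[-A],F)=0$ for all $F\in\mathcal U^{t\le 0}$, and for every $F\in\mathcal U^{t\le 0}$ there is a distinguished triangle $E\to F\to D\to E[1]$ with $D\in\mathcal U^{t\le -1}$ and $E\in\overline{\langle G\rangle}{}^{[-A,A]}$. It is *approximable* if $G$, $t$, $A$ can be chosen so that, moreover, one can always take $E\in\overline{\langle G\rangle}{}^{[-A,A]}_A$. **Statement.** Let $p$ be a prime, let $G=\mathbb Z/p$ (in degree $0$) in $D(\mathrm{Ab})$, and let $\mathcal U\subset D(\mathrm{Ab})$ be the full subcategory with object class $[\bigcup_{i\in\mathbb Z}G[i]\rangle$ (formed in $D(\mathrm{Ab})$), with the induced triangulated structure. Then: 1. $\mathcal U$ has all small coproducts, is compactly generated by $G$, and $G$ is weakly negative in $\mathcal U$. 2. $\mathcal U$ is weakly approximable. 3. $\mathcal U$ is not approximable. 4. For every integer $A>0$, every $E\in\overline{\langle G\rangle}{}^{[-A,A]}_A$ satisfies $p^A\cdot\mathrm{id}_E=0$. The object $F=\mathbb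 Z/p^{A+1}$ belongs to $\mathcal U$, and in fact to $\mathcal U^{\le 0}:=[\bigcup_{i\ge 0}G[i]\rangle$ (formed in $\mathcal U$); and there is no distinguished triangle $E\to F\to D\to E[1]$ in $\mathcal U$ with $E\in\overline{\langle G\rangle}{}^{[-A,A]}_A$ and $D\in\mathcal U^{\le 0}[1]$. In particular, a triangulated category that is compactly generated by a single weakly negative object need not be approximable, so in the criterion "compactly generated by a finite set $P=\bigcup_{0\le i\le n}P_i$ that is weakly negative and satisfies $\mathcal U(X,Y[1])=0$ for $X\in P_i$, $Y\in P_j$, $i\le j$, implies approximable" the second condition cannot be dropped. -/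

import Mathlib

open CategoryTheory CategoryTheory.Limits CategoryTheory.Pretriangulated

open scoped ZeroObject

universe u v w v' w'

namespace Approximability

noncomputable section

section General

variable {C : Type w'} [Category.{v'} C]

/-- The class of all coproducts of `u`-small families of elements of `P`. -/
def coproducts (P : ObjectProperty C) : ObjectProperty C :=
  fun X => ∃ ι : Type u, P.colimitsOfShape (Discrete ι) X

variable [HasShift C ℤ]

/-- The class `⋃_{i ∈ S} P[i]` (closed under isomorphisms). -/
def shifts (P : ObjectProperty C) (S : Set ℤ) : ObjectProperty C :=
  fun X => ∃ i ∈ S, ∃ Y, P Y ∧ Nonempty (X ≅ Y⟦i⟧)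

/-- The class `G[a, b]` of the objects `G[-i]` with `a ≤ i ≤ b`. -/
def shiftInterval (G : C) (a b : ℤ) : ObjectProperty C :=
  shifts (ObjectProperty.singleton G) {j | a ≤ -j ∧ -j ≤ b}

theorem shifts_univ_shift (P : ObjectProperty C) (X : C) (n : ℤ)
    (h : shifts P Set.univ X) : shifts P Set.univ (X⟦n⟧) := by
  obtain ⟨i, -, Y, hY, ⟨e⟩⟩ := h
  exact ⟨i + n, trivial, Y, hY,
    ⟨(shiftFunctor C n).mapIso e ≪≫ ((shiftFunctorAdd C i n).app Y).symm⟩⟩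

variable [Preadditive C]

/-- `X` is compact: the functor `C(X, -)` to abelian groups respects (`u`-small) coproducts. -/
def IsCompactObj (X : C) : Prop :=
  ∀ ι : Type u, PreservesColimitsOfShape (Discrete ι) (preadditiveCoyoneda.obj (Opposite.op X))

/-- `P` is weakly negative: `P ⟂ P[i]` for every `i > 1`. -/
def IsWeaklyNegative (P : ObjectProperty C) : Prop :=
  ∀ X Y : C, P X → P Y → ∀ i : ℤ, 1 < i → ∀ f : X ⟶ Y⟦i⟧, f = 0

variable [HasZeroObject C] [∀ n : ℤ, (shiftFunctor C n).Additive] [Pretriangulated C]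

/-- The big extension-closure of `P`: the smallest class of objects that contains `P` and the
zero objects, and is closed under extensions and under all `u`-small coproducts that exist
in `C`. -/
inductive bigExtensionClosure (P : ObjectProperty C) : ObjectProperty C
  | of_mem {X : C} (hX : P X) : bigExtensionClosure P X
  | of_isZero {X : C} (hX : IsZero X) : bigExtensionClosure P X
  | of_extension (T : Triangle C) (hT : T ∈ distTriang C) (h₁ : bigExtensionClosure P T.obj₁)
      (h₃ : bigExtensionClosure P T.obj₃) : bigExtensionClosure P T.obj₂
  | of_coproduct {ι : Type u} (F : ι → C) (c : Cofan F) (hc : Nonempty (IsColimit c))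
      (hF : ∀ i, bigExtensionClosure P (F i)) : bigExtensionClosure P c.pt

/-- `P` compactly generates `C`: all elements of `P` are compact, and the big extension-closure
of the class of all shifts of elements of `P` is the class of all objects. -/
def CompactlyGenerates (P : ObjectProperty C) : Prop :=
  (∀ X, P X → IsCompactObj.{u} X) ∧
    ∀ X, bigExtensionClosure.{u} (shifts P Set.univ) X

/-- `Coprod_n(P)`: `Coprod_1(P)` is the class of coproducts of elements of `P`, and
`Coprod_{n+1}(P) = Coprod_1(P) ⋆ Coprod_n(P)`, where `A ⋆ B` is the class of extensions of
elements of `B` by elements of `A` (and `Coprod_0(P)` is the class of zero objects). -/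
def coprodIter (P : ObjectProperty C) : ℕ → ObjectProperty C
  | 0 => fun X => IsZero X
  | n + 1 => (coproducts.{u} P).extensionProductIter n

/-- The class of all retracts of elements of `Coprod_n(G[a, b])`. -/
def generatedIn (G : C) (n : ℕ) (a b : ℤ) : ObjectProperty C :=
  (coprodIter.{u} (shiftInterval G a b) n).retractClosure

/-- The class of all retracts of elements of `Coprod(G[a, b])`, where `Coprod` is the
big extension-closure. -/
def generated (G : C) (a b : ℤ) : ObjectProperty C :=
  (bigExtensionClosure.{u} (shiftInterval G a b)).retractClosure

/-- The existence of a distinguished triangle `E ⟶ F ⟶ D ⟶ E[1]` with `E` in `P` and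
`D` in `Q`. -/
def HasApproximation (P Q : ObjectProperty C) (F : C) : Prop :=
  ObjectProperty.extensionProduct P Q F

variable (C)

/-- `C` has `u`-small coproducts, and there are a compact generator `G`, a t-structure `t`
and an integer `A > 0` such that

* `G[A] ∈ C^{t ≤ 0}` and `C(G[-A], F) = 0` for every `F ∈ C^{t ≤ 0}`;
* for every `F ∈ C^{t ≤ 0}` there is a distinguished triangle `E ⟶ F ⟶ D ⟶ E[1]` such that
  `D ∈ C^{t ≤ -1}` and `E` is a retract of an element of `Coprod(G[-A, A])`. -/
def IsWeaklyApproximable : Prop :=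
  HasCoproducts.{u} C ∧
    ∃ (G : C) (t : Triangulated.TStructure C) (A : ℕ), 0 < A ∧
      CompactlyGenerates.{u} (ObjectProperty.singleton G) ∧
      t.le 0 (G⟦(A : ℤ)⟧) ∧
      (∀ F : C, t.le 0 F → ∀ f : G⟦(-A : ℤ)⟧ ⟶ F, f = 0) ∧
      ∀ F : C, t.le 0 F → HasApproximation (generated.{u} G (-A) A) (t.le (-1)) F

/-- The same as weak approximability, except that `E` is required to be a retract of an element
of `Coprod_A(G[-A, A])`. -/
def IsApproximable : Prop :=
  HasCoproducts.{u} C ∧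
    ∃ (G : C) (t : Triangulated.TStructure C) (A : ℕ), 0 < A ∧
      CompactlyGenerates.{u} (ObjectProperty.singleton G) ∧
      t.le 0 (G⟦(A : ℤ)⟧) ∧
      (∀ F : C, t.le 0 F → ∀ f : G⟦(-A : ℤ)⟧ ⟶ F, f = 0) ∧
      ∀ F : C, t.le 0 F → HasApproximation (generatedIn.{u} G A (-A) A) (t.le (-1)) F

variable {C}

/-- The class of objects of the localizing subcategory generated by `G`. -/
def localizing (G : C) : ObjectProperty C :=
  bigExtensionClosure.{u} (shifts (ObjectProperty.singleton G) Set.univ)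

theorem bigExtensionClosure_shift (P : ObjectProperty C) (n : ℤ)
    (hP : ∀ X, P X → P (X⟦n⟧)) (X : C) (h : bigExtensionClosure.{u} P X) :
    bigExtensionClosure.{u} P (X⟦n⟧) := by
  induction h with
  | of_mem hX => exact .of_mem (hP _ hX)
  | of_isZero hX => exact .of_isZero ((shiftFunctor C n).map_isZero hX)
  | of_extension T hT _ _ h₁ h₃ =>
    exact .of_extension _ (Triangle.shift_distinguished T hT n) h₁ h₃
  | of_coproduct F c hc _ hF =>
    obtain ⟨hc⟩ := hc
    exact .of_coproduct (fun i => (F i)⟦n⟧)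
      (Cofan.mk (c.pt⟦n⟧) fun i => (c.inj i)⟦n⟧')
      ⟨isColimitCofanMkObjOfIsColimit (shiftFunctor C n) _ _ hc⟩ hF

theorem bigExtensionClosure_of_iso (P : ObjectProperty C) {X Y : C} (e : X ≅ Y)
    (h : bigExtensionClosure.{u} P X) : bigExtensionClosure.{u} P Y := by
  refine .of_extension (Triangle.mk e.hom (0 : Y ⟶ (0 : C)) 0) ?_ h (.of_isZero (isZero_zero C))
  refine isomorphic_distinguished _ (contractible_distinguished X) _ ?_
  exact Triangle.isoMk _ _ (Iso.refl _) e.symm (Iso.refl _)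
    (e.hom_inv_id.trans (Category.id_comp (𝟙 X)).symm) (zero_comp.trans comp_zero.symm)
    (zero_comp.trans comp_zero.symm)

instance (G : C) : (localizing.{u} G).IsClosedUnderIsomorphisms where
  of_iso e h := bigExtensionClosure_of_iso _ e h

instance (G : C) : (localizing.{u} G).IsTriangulated where
  exists_zero := ⟨0, isZero_zero C, .of_isZero (isZero_zero C)⟩
  isStableUnderShiftBy n :=
    ⟨fun X hX => bigExtensionClosure_shift _ n (fun Y hY => shifts_univ_shift _ Y n hY) X hX⟩
  ext₂' T hT h₁ h₃ := ObjectProperty.le_isoClosure _ _ (.of_extension T hT h₁ h₃)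

theorem localizing_self (G : C) : localizing.{u} G G :=
  .of_mem ⟨0, trivial, G, by simp, ⟨((shiftFunctorZero C ℤ).app G).symm⟩⟩

end General

section DerivedAb

variable [HasDerivedCategory.{w} AddCommGrpCat.{u}]

/-- The abelian group `ℤ/n`, placed in degree `0`, as an object of `D(Ab)`. -/
abbrev cyclicObj (n : ℕ) : DerivedCategory AddCommGrpCat.{u} :=
  (DerivedCategory.singleFunctor AddCommGrpCat.{u} 0).obj
    (AddCommGrpCat.of (ULift.{u} (ZMod n)))

/-- The full triangulated subcategory of `D(Ab)` compactly generated by `ℤ/p`. -/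
abbrev TorsionCat (p : ℕ) : Type (u + 1) :=
  (localizing.{u} (cyclicObj.{u, w} p)).FullSubcategory

/-- The object `ℤ/p` of `TorsionCat p`. -/
abbrev torsionGen (p : ℕ) : TorsionCat.{u, w} p :=
  ⟨cyclicObj.{u, w} p, localizing_self _⟩

/-- The class `[⋃_{i ≥ 0} G[i]⟩` for `G = ℤ/p`, formed in `TorsionCat p`; it is the class
`t ≤ 0` of the t-structure generated by `G`. -/
abbrev torsionAisle (p : ℕ) : ObjectProperty (TorsionCat.{u, w} p) :=
  bigExtensionClosure.{u} (shifts (ObjectProperty.singleton (torsionGen.{u, w} p)) (Set.Ici 0))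

end DerivedAb

end

end Approximability

universe t

/-! Everything rests on the triangle ℤ → ℤ → ℤ/p → ℤ[1] in D(Ab). As ℤ is compact and projective, G
= ℤ/p is compact and has no nonzero morphisms to G[i] for i > 1; both facts pass to the localizing
subcategory generated by G.

Weak approximability holds for every weakly negative compact generator with small Hom sets
(`isWeaklyApproximable_of_isWeaklyNegative`). The aisle U^{≤0} consists of the objects built from
G[i], i ≥ 0; its truncations come from a small object argument (`exists_aisle_triangle`). By weak
negativity [G⟩ has no nonzero morphisms to U^{≤0}[2], so extensions whose pieces come in the wrong
order split. Hence [G⟩ ⋆ U^{≤0}[1] is closed under extensions and contains U^{≤0}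
(`aisle_le_extensionProduct`). Nothing here bounds the number of extensions.

The obstruction to such a bound is torsion: n layers of coproducts of shifts of a q-torsion object
are q^n-torsion (`generatedIn.nsmul_id`), whereas the objects ℤ/p^N of [G⟩ have unbounded torsion.
In `not_isApproximable` the generator H, the t-structure t and A are arbitrary. Compactness shows
that some p^k kills H (`exists_pow_nsmul_id`) and that G and H are bounded above for t and for the
aisle of G, respectively (`IsCompactObj.exists_le`). Iterated approximation of a shift F[s] in
t^{≤0} yields a tower F[s] = X_0 → X_1 → ... with X_n in t^{≤-n}, where each stage costs a factor
p^{kA} (`nsmul_eq_zero_of_tower`). By `exists_forall_hom_eq_zero`, t^{≤0} is bounded as seen from G,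
so F[s] → X_n vanishes for one n that serves all F in [G⟩. Then p^{kAn} kills [G⟩, which is absurd.
The compactness arguments all use `IsCompactObj.exists_comp_map_eq_zero`: a sequence in which
morphisms from shifts of a generator eventually die has zero homotopy colimit.

For the standard aisle the contradiction is direct: ℤ → ℤ/p^{A+1} lifts to E, where p^A kills it,
although it has order p^{A+1}. -/

namespace Approximability

noncomputable section

/-! ### Compactness in terms of finite sums of components. -/

section Compact

variable {C : Type w'} [Category.{v'} C] [Preadditive C]

open Classical in
/-- The projection of a coproduct onto one of its summands. -/
def cofanProj {ι : Type t} {F : ι → C} {c : Cofan F} (hc : IsColimit c) (i : ι) : c.pt ⟶ F i :=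
  Cofan.IsColimit.desc hc fun j => if h : j = i then eqToHom (by rw [h]) else 0

@[simp]
lemma inj_cofanProj_self {ι : Type t} {F : ι → C} {c : Cofan F} (hc : IsColimit c) (i : ι) :
    c.inj i ≫ cofanProj hc i = 𝟙 _ := by
  simp [cofanProj]

@[simp]
lemma inj_cofanProj_self_assoc {ι : Type t} {F : ι → C} {c : Cofan F} (hc : IsColimit c) (i : ι)
    {A : C} (f : F i ⟶ A) : c.inj i ≫ cofanProj hc i ≫ f = f := by
  rw [← Category.assoc, inj_cofanProj_self, Category.id_comp]

lemma inj_cofanProj_of_ne {ι : Type t} {F : ι → C} {c : Cofan F} (hc : IsColimit c) {i j : ι}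
    (h : j ≠ i) : c.inj j ≫ cofanProj hc i = 0 := by
  simp [cofanProj, h]

lemma inj_cofanProj_of_ne_assoc {ι : Type t} {F : ι → C} {c : Cofan F} (hc : IsColimit c)
    {i j : ι} (h : j ≠ i) {A : C} (f : F i ⟶ A) : c.inj j ≫ cofanProj hc i ≫ f = 0 := by
  rw [← Category.assoc, inj_cofanProj_of_ne hc h, zero_comp]

/-- A morphism into a coproduct that is a finite sum of morphisms into summands is determined
by its components. -/
lemma exists_finset_of_eq_sum {ι : Type t} {F : ι → C} {c : Cofan F} (hc : IsColimit c) {K : C}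
    (s : Finset ι) (g : ∀ i, K ⟶ F i) (T : Finset ι) (hT : s ⊆ T) :
    ∑ j ∈ T, (∑ i ∈ s, g i ≫ c.inj i) ≫ cofanProj hc j ≫ c.inj j = ∑ i ∈ s, g i ≫ c.inj i := by
  classical
  rw [← Finset.sum_subset hT]
  · refine Finset.sum_congr rfl fun j hj => ?_
    rw [Preadditive.sum_comp, Finset.sum_eq_single j]
    · simp
    · intro i _ hij
      simp [inj_cofanProj_of_ne_assoc hc hij]
    · exact fun h => (h hj).elim
  · intro j _ hj
    rw [Preadditive.sum_comp]
    refine Finset.sum_eq_zero fun i hi => ?_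
    simp [inj_cofanProj_of_ne_assoc hc (show i ≠ j by rintro rfl; exact hj hi)]

/-- The finite sums generate a subgroup. The projection to the quotient by it vanishes on every
summand, so it is zero by the colimit property of Hom(K, -). -/
lemma IsCompactObj.exists_sum {K : C} (hK : IsCompactObj.{u} K) {ι : Type t} [Small.{u} ι]
    {F : ι → C} {c : Cofan F} (hc : IsColimit c) (f : K ⟶ c.pt) :
    ∃ (s : Finset ι) (g : ∀ i, K ⟶ F i), f = ∑ i ∈ s, g i ≫ c.inj i := by
  classical
  let Φ := preadditiveCoyoneda.obj (Opposite.op K)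
  have : PreservesColimitsOfShape (Discrete ι) Φ :=
    have := hK (Shrink.{u} ι)
    preservesColimitsOfShape_of_equiv (Discrete.equivalence (equivShrink.{u} ι).symm) Φ
  have hc' := isColimitOfPreserves Φ hc
  let S : AddSubgroup (K ⟶ c.pt) :=
    AddSubgroup.closure {f | ∃ (i : ι) (g : K ⟶ F i), f = g ≫ c.inj i}
  let q : Φ.obj c.pt ⟶ AddCommGrpCat.of ((K ⟶ c.pt) ⧸ S) :=
    AddCommGrpCat.ofHom (QuotientAddGroup.mk' S)
  have hq : q = 0 := by
    refine hc'.hom_ext fun ⟨i⟩ => ?_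
    ext g
    exact (QuotientAddGroup.eq_zero_iff _).2 (AddSubgroup.subset_closure ⟨i, g, rfl⟩)
  have hf : f ∈ S := (QuotientAddGroup.eq_zero_iff _).1 (ConcreteCategory.congr_hom hq f)
  -- Asking for all larger finite sets allows the sets belonging to two terms to be merged.
  have H : ∀ f ∈ S, ∃ s : Finset ι, ∀ T, s ⊆ T → ∑ j ∈ T, f ≫ cofanProj hc j ≫ c.inj j = f := by
    intro f hf
    induction hf using AddSubgroup.closure_induction with
    | mem f hf =>
      obtain ⟨i, g, rfl⟩ := hf
      refine ⟨{i}, fun T hT => ?_⟩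
      rw [Finset.sum_eq_single i]
      · simp
      · intro j _ hij
        simp [inj_cofanProj_of_ne_assoc hc hij.symm]
      · exact fun h => (h (hT (by simp))).elim
    | zero => exact ⟨∅, by simp⟩
    | add x y _ _ hx hy =>
      obtain ⟨s, hs⟩ := hx
      obtain ⟨s', hs'⟩ := hy
      refine ⟨s ∪ s', fun T hT => ?_⟩
      simp only [Preadditive.add_comp, Finset.sum_add_distrib]
      rw [hs T (Finset.union_subset_left hT), hs' T (Finset.union_subset_right hT)]
    | neg x _ hx =>
      obtain ⟨s, hs⟩ := hx
      refine ⟨s, fun T hT => ?_⟩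
      simp only [Preadditive.neg_comp, Finset.sum_neg_distrib]
      rw [hs T hT]
  obtain ⟨s, hs⟩ := H f hf
  exact ⟨s, fun i => f ≫ cofanProj hc i, by simpa using (hs s subset_rfl).symm⟩

/-- A morphism from a compact object to a coproduct is the sum of its components. -/
lemma IsCompactObj.exists_finset {K : C} (hK : IsCompactObj.{u} K) {ι : Type t} [Small.{u} ι]
    {F : ι → C} {c : Cofan F} (hc : IsColimit c) (f : K ⟶ c.pt) :
    ∃ s : Finset ι, ∀ T, s ⊆ T → ∑ j ∈ T, f ≫ cofanProj hc j ≫ c.inj j = f := by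
  obtain ⟨s, g, rfl⟩ := hK.exists_sum hc f
  exact ⟨s, exists_finset_of_eq_sum hc s g⟩

lemma IsCompactObj.hom_ext {K : C} (hK : IsCompactObj.{u} K) {ι : Type t} [Small.{u} ι]
    {F : ι → C} {c : Cofan F} (hc : IsColimit c) {f g : K ⟶ c.pt}
    (h : ∀ i, f ≫ cofanProj hc i = g ≫ cofanProj hc i) : f = g := by
  rw [← sub_eq_zero]
  obtain ⟨s, hs⟩ := hK.exists_finset hc (f - g)
  rw [← hs s subset_rfl]
  refine Finset.sum_eq_zero fun i _ => ?_
  rw [← Category.assoc, Preadditive.sub_comp, h, sub_self, zero_comp]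

/-- Converse of `IsCompactObj.exists_sum`; compactness is verified below in this form. -/
lemma isCompactObj_of_exists_sum {K : C}
    (h : ∀ {ι : Type u} (F : ι → C) (c : Cofan F) (_ : IsColimit c) (f : K ⟶ c.pt),
      ∃ (s : Finset ι) (g : ∀ i, K ⟶ F i), f = ∑ i ∈ s, g i ≫ c.inj i) :
    IsCompactObj.{u} K := by
  classical
  intro ι
  constructor
  intro D
  suffices PreservesColimit (Discrete.functor (D.obj ∘ Discrete.mk))
      (preadditiveCoyoneda.obj (Opposite.op K)) from
    preservesColimit_of_iso_diagram _ (Discrete.natIsoFunctor (F := D)).symm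
  constructor
  intro (c : Cofan _) hc
  have H : ∀ f : K ⟶ c.pt, ∃ s : Finset ι, ∀ T, s ⊆ T →
      ∑ j ∈ T, f ≫ cofanProj hc j ≫ c.inj j = f := by
    intro f
    obtain ⟨s, g, rfl⟩ := h _ c hc f
    exact ⟨s, exists_finset_of_eq_sum hc s g⟩
  have hzero : ∀ (f : K ⟶ c.pt) (s : Finset ι), (∀ T, s ⊆ T →
      ∑ j ∈ T, f ≫ cofanProj hc j ≫ c.inj j = f) → ∀ i, i ∉ s → f ≫ cofanProj hc i = 0 := by
    intro f s hs i his
    have h1 := hs s subset_rfl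
    have h2 := hs (insert i s) (Finset.subset_insert _ _)
    rw [Finset.sum_insert his, h1, add_eq_right] at h2
    simpa using h2 =≫ cofanProj hc i
  refine ⟨?_⟩
  let E : ∀ s : Cocone (Discrete.functor (D.obj ∘ Discrete.mk) ⋙
      preadditiveCoyoneda.obj (Opposite.op K)), ∀ i, (K ⟶ D.obj ⟨i⟩) →+ s.pt :=
    fun s i => (s.ι.app ⟨i⟩).hom
  have hsupp : ∀ s (f : K ⟶ c.pt) (S : Finset ι), (∀ T, S ⊆ T →
      ∑ j ∈ T, f ≫ cofanProj hc j ≫ c.inj j = f) → Function.support (fun i =>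
      E s i (f ≫ cofanProj hc i)) ⊆ S := by
    intro s f S hS i hi
    by_contra his
    refine hi ?_
    change E s i (f ≫ cofanProj hc i) = 0
    rw [hzero f S hS i his]
    exact map_zero _
  have hfin' : ∀ s (f : K ⟶ c.pt), (Function.support fun i =>
      E s i (f ≫ cofanProj hc i)).Finite := by
    intro s f
    obtain ⟨S, hS⟩ := H f
    exact S.finite_toSet.subset (hsupp s f S hS)
  -- The descended map adds up the values of the cocone on the components of `f`, only finitely many
  -- of which are nonzero.
  let P : ∀ s : Cocone (Discrete.functor (D.obj ∘ Discrete.mk) ⋙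
      preadditiveCoyoneda.obj (Opposite.op K)), (K ⟶ c.pt) →+ s.pt := fun s =>
    { toFun := fun f => ∑ᶠ i, E s i (f ≫ cofanProj hc i)
      map_zero' := by
        refine finsum_eq_zero_of_forall_eq_zero fun i => ?_
        rw [zero_comp]
        exact map_zero (E s i)
      map_add' := fun f g => by
        rw [← finsum_add_distrib (hfin' s f) (hfin' s g)]
        refine finsum_congr fun i => ?_
        rw [Preadditive.add_comp]
        exact map_add (E s i) _ _ }
  refine
    { desc := fun s => AddCommGrpCat.ofHom (P s)
      fac := fun s ⟨i⟩ => ?_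
      uniq := fun s m hm => ?_ }
  · ext (g : K ⟶ D.obj ⟨i⟩)
    change ∑ᶠ j, E s j ((g ≫ c.inj i) ≫ cofanProj hc j) = E s i g
    rw [finsum_eq_single _ i]
    · simp
    · intro j hj
      rw [Category.assoc, inj_cofanProj_of_ne hc hj.symm, comp_zero]
      exact map_zero _
  · ext (f : K ⟶ c.pt)
    let m' : (K ⟶ c.pt) →+ s.pt := m.hom
    change m' f = ∑ᶠ j, E s j (f ≫ cofanProj hc j)
    obtain ⟨S, hS⟩ := H f
    rw [finsum_eq_sum_of_support_subset _ (hsupp s f S hS)]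
    conv_lhs => rw [← hS S subset_rfl]
    rw [map_sum]
    refine Finset.sum_congr rfl fun j _ => ?_
    rw [← Category.assoc]
    have := hm ⟨j⟩
    exact congr($(this).hom (f ≫ cofanProj hc j))

end Compact

/-! ### Shifts, coproducts of triangles, orthogonality and homotopy colimits. -/

section Triangulated

variable {C : Type w'} [Category.{v'} C] [Preadditive C] [HasShift C ℤ]
  [∀ n : ℤ, (shiftFunctor C n).Additive]

/-- The coproduct of the shifts is the shift of the coproduct. -/
def isColimitShiftCofan {ι : Type t} {F : ι → C} {c : Cofan F} (hc : IsColimit c) (n : ℤ) :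
    IsColimit (Cofan.mk (c.pt⟦n⟧) fun i => (c.inj i)⟦n⟧') :=
  isColimitCofanMkObjOfIsColimit (shiftFunctor C n) _ _ hc

/-- Shifting moves from the source to the target of morphisms. -/
def shiftHomEquiv {a b : ℤ} (h : a + b = 0) (K Y : C) : (K⟦a⟧ ⟶ Y) ≃+ (K ⟶ Y⟦b⟧) :=
  { (shiftEquiv' C a b h).toAdjunction.homEquiv K Y with
    map_add' := fun f g => by
      have H : ∀ f : K⟦a⟧ ⟶ Y, (shiftEquiv' C a b h).toAdjunction.homEquiv K Y f =
          (shiftEquiv' C a b h).toAdjunction.unit.app K ≫ f⟦b⟧' := fun f =>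
        Adjunction.homEquiv_unit ..
      exact (H _).trans (((congrArg _ (shiftFunctor C b).map_add).trans
        (Preadditive.comp_add _ _ _ _ _ _)).trans (congrArg₂ _ (H f).symm (H g).symm)) }

lemma shiftHomEquiv_comp {a b : ℤ} (h : a + b = 0) {K Y Z : C} (f : K⟦a⟧ ⟶ Y) (g : Y ⟶ Z) :
    shiftHomEquiv h K Z (f ≫ g) = shiftHomEquiv h K Y f ≫ g⟦b⟧' :=
  (shiftEquiv' C a b h).toAdjunction.homEquiv_naturality_right f g

lemma shiftHomEquiv_symm_comp {a b : ℤ} (h : a + b = 0) {K Y Z : C} (f : K ⟶ Y⟦b⟧) (g : Y ⟶ Z) :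
    (shiftHomEquiv h K Z).symm (f ≫ g⟦b⟧') = (shiftHomEquiv h K Y).symm f ≫ g := by
  rw [AddEquiv.symm_apply_eq, shiftHomEquiv_comp, AddEquiv.apply_symm_apply]

lemma IsCompactObj.shift {K : C} (hK : IsCompactObj.{u} K) (n : ℤ) :
    IsCompactObj.{u} (K⟦n⟧) := by
  refine isCompactObj_of_exists_sum fun {ι} F c hc f => ?_
  have hn : n + -n = 0 := by simp
  obtain ⟨s, g, hg⟩ : ∃ (s : Finset ι) (g : ∀ i, K ⟶ (F i)⟦-n⟧),
      shiftHomEquiv hn _ _ f = ∑ i ∈ s, g i ≫ (c.inj i)⟦-n⟧' :=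
    hK.exists_sum (isColimitShiftCofan hc (-n)) (shiftHomEquiv hn _ _ f)
  refine ⟨s, fun i => (shiftHomEquiv hn _ _).symm (g i), ?_⟩
  rw [← (shiftHomEquiv hn _ _).symm_apply_apply f, hg, map_sum]
  exact Finset.sum_congr rfl fun i _ => shiftHomEquiv_symm_comp hn _ _

/-- By adjunction, injectivity of `φ` on morphisms from `H[-1]` is injectivity of `φ[1]` on
morphisms from `H`; this controls connecting morphisms. -/
lemma eq_zero_of_comp_shift {H A B : C} (φ : A ⟶ B)
    (hφ : ∀ g : H⟦(-1 : ℤ)⟧ ⟶ A, g ≫ φ = 0 → g = 0) (f : H ⟶ A⟦(1 : ℤ)⟧)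
    (hf : f ≫ φ⟦(1 : ℤ)⟧' = 0) : f = 0 := by
  have h : (-1 : ℤ) + 1 = 0 := by simp
  rw [← map_eq_zero_iff _ (shiftHomEquiv h H A).symm.injective]
  apply hφ
  rw [← shiftHomEquiv_symm_comp, hf, map_zero]

variable [HasZeroObject C] [Pretriangulated C]

/-- A coproduct of distinguished triangles is distinguished. -/
lemma exists_distTriang_of_isColimit {ι : Type t} (T : ι → Triangle C)
    (hT : ∀ i, T i ∈ distTriang C)
    {c₁ : Cofan fun i => (T i).obj₁} (hc₁ : IsColimit c₁)
    {c₂ : Cofan fun i => (T i).obj₂} (hc₂ : IsColimit c₂)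
    {c₃ : Cofan fun i => (T i).obj₃} (hc₃ : IsColimit c₃) :
    ∃ (f : c₁.pt ⟶ c₂.pt) (g : c₂.pt ⟶ c₃.pt) (h : c₃.pt ⟶ c₁.pt⟦(1 : ℤ)⟧),
      Triangle.mk f g h ∈ distTriang C ∧
      (∀ i, c₁.inj i ≫ f = (T i).mor₁ ≫ c₂.inj i) := by
  let f₁ : c₁.pt ⟶ c₂.pt := Cofan.IsColimit.desc hc₁ fun i => (T i).mor₁ ≫ c₂.inj i
  have hf₁ : ∀ i, c₁.inj i ≫ f₁ = (T i).mor₁ ≫ c₂.inj i := fun i =>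
    Cofan.IsColimit.fac hc₁ _ _
  obtain ⟨Z, f₂, f₃, hT'⟩ := distinguished_cocone_triangle f₁
  have H : ∀ i, ∃ φ : (T i).obj₃ ⟶ Z, (T i).mor₂ ≫ φ = c₂.inj i ≫ f₂ ∧
      (T i).mor₃ ≫ (c₁.inj i)⟦(1 : ℤ)⟧' = φ ≫ f₃ := fun i =>
    complete_distinguished_triangle_morphism _ _ (hT i) hT' (c₁.inj i) (c₂.inj i) (hf₁ i).symm
  choose φ hφ₂ hφ₃ using H
  let ψ : c₃.pt ⟶ Z := Cofan.IsColimit.desc hc₃ φ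
  have hψ : ∀ i, c₃.inj i ≫ ψ = φ i := fun i => Cofan.IsColimit.fac hc₃ _ _
  let hs₁ := isColimitShiftCofan hc₁ 1
  let hs₂ := isColimitShiftCofan hc₂ 1
  have hext₁ : ∀ {A : C} (a b : c₁.pt⟦(1 : ℤ)⟧ ⟶ A),
      (∀ i, (c₁.inj i)⟦(1 : ℤ)⟧' ≫ a = (c₁.inj i)⟦(1 : ℤ)⟧' ≫ b) → a = b :=
    fun a b h => Cofan.IsColimit.hom_ext hs₁ a b h
  -- A five lemma by hand: Hom(-, A) turns the coproducts into products of exact sequences, so `ψ`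
  -- induces a bijection for every `A`.
  have hψiso : IsIso ψ := by
    refine isIso_of_coyoneda_map_bijective _ fun A => ⟨?_, ?_⟩
    · suffices ∀ a : Z ⟶ A, ψ ≫ a = 0 → a = 0 from fun a b hab => by
        rw [← sub_eq_zero]
        refine this _ ?_
        rw [Preadditive.comp_sub, sub_eq_zero]
        exact hab
      intro a ha
      have hφa : ∀ i, φ i ≫ a = 0 := fun i => by rw [← hψ, Category.assoc, ha, comp_zero]
      have h2 : f₂ ≫ a = 0 := Cofan.IsColimit.hom_ext hc₂ _ _ fun i => by
        rw [← Category.assoc, ← hφ₂, Category.assoc, hφa, comp_zero, comp_zero]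
      obtain ⟨b, hb⟩ : ∃ b, a = f₃ ≫ b := Triangle.yoneda_exact₃ _ hT' a h2
      have hb' : ∀ i, (T i).mor₃ ≫ (c₁.inj i)⟦(1 : ℤ)⟧' ≫ b = 0 := fun i => by
        rw [← Category.assoc, hφ₃, Category.assoc, ← hb, hφa]
      have h3 : ∀ i, ∃ β : (T i).obj₂⟦(1 : ℤ)⟧ ⟶ A,
          (c₁.inj i)⟦(1 : ℤ)⟧' ≫ b = (T i).mor₁⟦(1 : ℤ)⟧' ≫ β := fun i => by
        obtain ⟨β, hβ⟩ : ∃ β : (T i).obj₂⟦(1 : ℤ)⟧ ⟶ A,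
            (c₁.inj i)⟦(1 : ℤ)⟧' ≫ b = (-((T i).mor₁⟦(1 : ℤ)⟧')) ≫ β :=
          Triangle.yoneda_exact₃ _ (rot_of_distTriang _ (hT i)) _ (hb' i)
        refine ⟨-β, hβ.trans ?_⟩
        rw [Preadditive.neg_comp, Preadditive.comp_neg]
      choose β hβ using h3
      have h4 : b = f₁⟦(1 : ℤ)⟧' ≫ Cofan.IsColimit.desc hs₂ β := hext₁ _ _ fun i => by
        rw [hβ, ← Category.assoc, ← Functor.map_comp, hf₁, Functor.map_comp, Category.assoc]
        congr 1
        exact (Cofan.IsColimit.fac hs₂ _ i).symm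
      have h5 : f₃ ≫ f₁⟦(1 : ℤ)⟧' = 0 := comp_distTriang_mor_zero₃₁ _ hT'
      rw [hb, h4, reassoc_of% h5, zero_comp]
    · intro x
      let y : c₂.pt ⟶ A := Cofan.IsColimit.desc hc₂ fun i => (T i).mor₂ ≫ c₃.inj i ≫ x
      have hy : ∀ i, c₂.inj i ≫ y = (T i).mor₂ ≫ c₃.inj i ≫ x := fun i =>
        Cofan.IsColimit.fac hc₂ _ _
      have h1 : f₁ ≫ y = 0 := Cofan.IsColimit.hom_ext hc₁ _ _ fun i => by
        rw [← Category.assoc, hf₁, Category.assoc, hy, ← Category.assoc,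
          comp_distTriang_mor_zero₁₂ _ (hT i), zero_comp, comp_zero]
      obtain ⟨z, hz⟩ : ∃ z, y = f₂ ≫ z := Triangle.yoneda_exact₂ _ hT' y h1
      have h2 : ∀ i, ∃ w : (T i).obj₁⟦(1 : ℤ)⟧ ⟶ A,
          c₃.inj i ≫ (x - ψ ≫ z) = (T i).mor₃ ≫ w := fun i => by
        refine Triangle.yoneda_exact₃ _ (hT i) _ ?_
        rw [Preadditive.comp_sub, Preadditive.comp_sub, ← hy, ← Category.assoc (c₃.inj i), hψ,
          ← Category.assoc, hφ₂, Category.assoc, hz, sub_self]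
      choose w hw using h2
      refine ⟨z + f₃ ≫ Cofan.IsColimit.desc hs₁ w, ?_⟩
      change ψ ≫ (z + f₃ ≫ Cofan.IsColimit.desc hs₁ w) = x
      rw [Preadditive.comp_add, ← eq_sub_iff_add_eq']
      refine Cofan.IsColimit.hom_ext hc₃ _ _ fun i => ?_
      rw [hw, ← Category.assoc, hψ, ← Category.assoc, ← hφ₃, Category.assoc]
      congr 1
      exact Cofan.IsColimit.fac hs₁ _ i
  let e : c₃.pt ≅ Z := asIso ψ
  refine ⟨f₁, f₂ ≫ e.inv, e.hom ≫ f₃, ?_, hf₁⟩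
  exact isomorphic_distinguished _ hT' _
    (Triangle.isoMk _ _ (Iso.refl _) (Iso.refl _) e
      ((Category.comp_id _).trans (Category.id_comp _).symm)
      (by
        change (f₂ ≫ e.inv) ≫ e.hom = 𝟙 _ ≫ f₂
        rw [Category.assoc, e.inv_hom_id, Category.comp_id, Category.id_comp])
      (by
        change (e.hom ≫ f₃) ≫ (𝟙 c₁.pt)⟦(1 : ℤ)⟧' = e.hom ≫ f₃
        rw [CategoryTheory.Functor.map_id, Category.comp_id]))

/-! ### Orthogonality and extension closures -/

lemma bigExtensionClosure.hom_eq_zero {P : ObjectProperty C} {Y : C}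
    (hP : ∀ X, P X → ∀ f : X ⟶ Y, f = 0) {X : C} (hX : bigExtensionClosure.{u} P X)
    (f : X ⟶ Y) : f = 0 := by
  induction hX with
  | of_mem hX => exact hP _ hX f
  | of_isZero hX => exact hX.eq_of_src _ _
  | of_extension T hT _ _ h₁ h₃ =>
    obtain ⟨g, rfl⟩ := Triangle.yoneda_exact₂ T hT f (h₁ _)
    rw [h₃ g, comp_zero]
  | of_coproduct F c hc _ hF =>
    obtain ⟨hc⟩ := hc
    exact Cofan.IsColimit.hom_ext hc _ _ fun i =>
      (hF i _).trans (hF i _).symm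

lemma IsCompactObj.hom_eq_zero {K : C} (hK : IsCompactObj.{u} K) {P : ObjectProperty C}
    (hP : ∀ X, P X → ∀ f : K ⟶ X, f = 0) {X : C} (hX : bigExtensionClosure.{u} P X)
    (f : K ⟶ X) : f = 0 := by
  induction hX with
  | of_mem hX => exact hP _ hX f
  | of_isZero hX => exact hX.eq_of_tgt _ _
  | of_extension T hT _ _ h₁ h₃ =>
    obtain ⟨g, rfl⟩ := Triangle.coyoneda_exact₂ T hT f (h₃ _)
    rw [h₁ g, zero_comp]
  | of_coproduct F c hc _ hF =>
    obtain ⟨hc⟩ := hc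
    exact hK.hom_ext hc fun i =>
      (hF i _).trans (hF i _).symm

lemma bigExtensionClosure.le_of_le {P Q : ObjectProperty C}
    (h : ∀ X, P X → bigExtensionClosure.{u} Q X) {X : C} (hX : bigExtensionClosure.{u} P X) :
    bigExtensionClosure.{u} Q X := by
  induction hX with
  | of_mem hX => exact h _ hX
  | of_isZero hX => exact .of_isZero hX
  | of_extension T hT _ _ h₁ h₃ => exact .of_extension T hT h₁ h₃
  | of_coproduct F c hc _ hF => exact .of_coproduct F c hc hF

/-- The identity of `Y` is a morphism to `Y` from an object built out of shifts of `G`. -/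
lemma isZero_of_hom_eq_zero {G : C} (hG : ∀ X, bigExtensionClosure.{u}
    (shifts (ObjectProperty.singleton G) Set.univ) X) {Y : C}
    (hY : ∀ (i : ℤ) (f : G⟦i⟧ ⟶ Y), f = 0) : IsZero Y := by
  rw [IsZero.iff_id_eq_zero]
  refine (hG Y).hom_eq_zero ?_ (𝟙 Y)
  rintro X ⟨i, -, G', hG', ⟨e⟩⟩ f
  obtain rfl : G = G' := by simpa using hG'
  rw [← cancel_epi e.inv, hY _ (e.inv ≫ f), comp_zero]

/-! ### Sequential homotopy colimits -/

section Telescope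

set_option linter.unusedSectionVars false

variable [HasCoproductsOfShape ℕ C] (X : ℕ ⥤ C)

/-- The coproduct of the objects of a sequence. -/
abbrev seqCofan : Cofan X.obj := Cofan.mk (∐ X.obj) (Sigma.ι X.obj)

/-- `seqCofan X` is a coproduct. -/
abbrev isColimitSeqCofan : IsColimit (seqCofan X) := coproductIsCoproduct X.obj

/-- The endomorphism `1 - shift` of the coproduct of a sequence. -/
def telescopeMap : ∐ X.obj ⟶ ∐ X.obj :=
  Sigma.desc fun n => Sigma.ι X.obj n - X.map (homOfLE n.le_succ) ≫ Sigma.ι X.obj (n + 1)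

lemma ι_telescopeMap (n : ℕ) : Sigma.ι X.obj n ≫ telescopeMap X =
    Sigma.ι X.obj n - X.map (homOfLE n.le_succ) ≫ Sigma.ι X.obj (n + 1) := by
  simp [telescopeMap]

/-- The projection of the coproduct of a sequence to one of its terms. -/
abbrev seqProj (n : ℕ) : ∐ X.obj ⟶ X.obj n := cofanProj (isColimitSeqCofan X) n

lemma ι_seqProj_self (n : ℕ) : Sigma.ι X.obj n ≫ seqProj X n = 𝟙 _ :=
  inj_cofanProj_self (isColimitSeqCofan X) n

lemma ι_seqProj_of_ne {n m : ℕ} (h : n ≠ m) : Sigma.ι X.obj n ≫ seqProj X m = 0 :=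
  inj_cofanProj_of_ne (isColimitSeqCofan X) h

lemma telescopeMap_seqProj_zero : telescopeMap X ≫ seqProj X 0 = seqProj X 0 := by
  refine Sigma.hom_ext _ _ fun n => ?_
  rw [← Category.assoc, ι_telescopeMap, Preadditive.sub_comp, Category.assoc,
    ι_seqProj_of_ne X (Nat.succ_ne_zero n), comp_zero, sub_zero]

lemma telescopeMap_seqProj_succ (m : ℕ) : telescopeMap X ≫ seqProj X (m + 1) =
    seqProj X (m + 1) - seqProj X m ≫ X.map (homOfLE m.le_succ) := by
  refine Sigma.hom_ext _ _ fun n => ?_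
  rw [← Category.assoc, ι_telescopeMap, Preadditive.sub_comp, Category.assoc,
    Preadditive.comp_sub]
  congr 1
  by_cases h : n = m
  · subst h
    rw [ι_seqProj_self, Category.comp_id, ← Category.assoc, ι_seqProj_self, Category.id_comp]
  · rw [ι_seqProj_of_ne X (by lia), comp_zero, ← Category.assoc, ι_seqProj_of_ne X h, zero_comp]

/-- The component of `h ≫ telescopeMap X` at `n + 1` is that of `h` minus the image of its component
at `n`, so the components of `h` vanish one after another; compactness makes them detect `h`. -/
lemma IsCompactObj.eq_zero_of_comp_telescopeMap {H : C} (hH : IsCompactObj.{u} H)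
    (h : H ⟶ ∐ X.obj) (hh : h ≫ telescopeMap X = 0) : h = 0 := by
  refine hH.hom_ext (isColimitSeqCofan X) fun n => ?_
  rw [zero_comp]
  change h ≫ seqProj X n = 0
  induction n with
  | zero => rw [← telescopeMap_seqProj_zero, ← Category.assoc, hh, zero_comp]
  | succ n hn =>
    have h1 := h ≫= telescopeMap_seqProj_succ X n
    rw [Preadditive.comp_sub, ← Category.assoc, hh, zero_comp, ← Category.assoc h, hn, zero_comp,
      sub_zero] at h1
    exact h1.symm

/-- The difference is a telescoping sum of terms that factor through `1 - shift`. -/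
lemma exists_comp_telescopeMap {n m : ℕ} (h : n ≤ m) : ∃ e : X.obj n ⟶ ∐ X.obj,
    e ≫ telescopeMap X = Sigma.ι X.obj n - X.map (homOfLE h) ≫ Sigma.ι X.obj m := by
  induction m, h using Nat.le_induction with
  | base =>
    refine ⟨0, ?_⟩
    rw [zero_comp, show X.map (homOfLE (le_refl n)) = 𝟙 _ from X.map_id n, Category.id_comp,
      sub_self]
  | succ m h ih =>
    obtain ⟨e, he⟩ := ih
    refine ⟨e + X.map (homOfLE h) ≫ Sigma.ι X.obj m, ?_⟩
    rw [Preadditive.add_comp, he, Category.assoc, ι_telescopeMap, Preadditive.comp_sub,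
      ← Category.assoc, ← X.map_comp, homOfLE_comp]
    abel

lemma ι_comp_eq_of_telescopeMap_comp {B : C} (q : ∐ X.obj ⟶ B) (hq : telescopeMap X ≫ q = 0)
    {n m : ℕ} (h : n ≤ m) :
    Sigma.ι X.obj n ≫ q = X.map (homOfLE h) ≫ Sigma.ι X.obj m ≫ q := by
  obtain ⟨e, he⟩ := exists_comp_telescopeMap X h
  have := he =≫ q
  rw [Category.assoc, hq, comp_zero, Preadditive.sub_comp, Category.assoc] at this
  exact (sub_eq_zero.1 this.symm)

/-- Morphisms from a compact object to a sequential homotopy colimit factor through a term of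
the sequence. -/
lemma IsCompactObj.exists_lift_hocolim {H : C} (hH : IsCompactObj.{u} H) {B : C}
    (q : ∐ X.obj ⟶ B) (δ : B ⟶ (∐ X.obj)⟦(1 : ℤ)⟧)
    (hT : Triangle.mk (telescopeMap X) q δ ∈ distTriang C) (k : H ⟶ B) :
    ∃ (n : ℕ) (h : H ⟶ X.obj n), k = h ≫ Sigma.ι X.obj n ≫ q := by
  have hq : telescopeMap X ≫ q = 0 := comp_distTriang_mor_zero₁₂ _ hT
  have hδ : δ ≫ (telescopeMap X)⟦(1 : ℤ)⟧' = 0 := comp_distTriang_mor_zero₃₁ _ hT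
  have hk : k ≫ δ = 0 := by
    refine eq_zero_of_comp_shift (telescopeMap X)
      (fun g hg => (hH.shift (-1)).eq_zero_of_comp_telescopeMap X g hg) _ ?_
    rw [Category.assoc, hδ, comp_zero]
  obtain ⟨h, rfl⟩ : ∃ h, k = h ≫ q := Triangle.coyoneda_exact₃ _ hT k hk
  obtain ⟨s, g, rfl⟩ : ∃ (s : Finset ℕ) (g : ∀ i, H ⟶ X.obj i),
      h = ∑ i ∈ s, g i ≫ Sigma.ι X.obj i := hH.exists_sum (isColimitSeqCofan X) h
  clear hk
  induction s using Finset.induction_on with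
  | empty => exact ⟨0, 0, by simp⟩
  | insert a s ha ih =>
    obtain ⟨n, h, hh⟩ := ih
    refine ⟨max a n, g a ≫ X.map (homOfLE (le_max_left a n)) +
      h ≫ X.map (homOfLE (le_max_right a n)), ?_⟩
    rw [Finset.sum_insert ha, Preadditive.add_comp, hh, Preadditive.add_comp, Category.assoc,
      Category.assoc, Category.assoc, ← ι_comp_eq_of_telescopeMap_comp X q hq,
      ← ι_comp_eq_of_telescopeMap_comp X q hq]

/-- If every morphism from a shift of a compact generator to a term of a sequence vanishes
further on in the sequence, then so does every morphism from a compact object. -/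
theorem IsCompactObj.exists_comp_map_eq_zero {G : C} (hG : IsCompactObj.{u} G)
    (hgen : ∀ X, bigExtensionClosure.{u} (shifts (ObjectProperty.singleton G) Set.univ) X)
    (hX : ∀ (i : ℤ) (n : ℕ) (a : G⟦i⟧ ⟶ X.obj n), ∃ (m : ℕ) (h : n ≤ m),
      a ≫ X.map (homOfLE h) = 0)
    {K : C} (hK : IsCompactObj.{u} K) (k : K ⟶ X.obj 0) :
    ∃ m, k ≫ X.map (homOfLE (Nat.zero_le m)) = 0 := by
  obtain ⟨B, q, δ, hT⟩ := distinguished_cocone_triangle (telescopeMap X)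
  have hq : telescopeMap X ≫ q = 0 := comp_distTriang_mor_zero₁₂ _ hT
  -- A morphism from a shift of `G` to the homotopy colimit comes from a finite stage and dies at a
  -- later one.
  have hB : IsZero B := by
    refine isZero_of_hom_eq_zero hgen fun i f => ?_
    obtain ⟨n, h, rfl⟩ := (hG.shift i).exists_lift_hocolim X q δ hT f
    obtain ⟨m, hnm, hm⟩ := hX i n h
    rw [ι_comp_eq_of_telescopeMap_comp X q hq hnm, ← Category.assoc, hm, zero_comp]
  have hΦ : IsIso (telescopeMap X) := (Triangle.isZero₃_iff_isIso₁ _ hT).1 hB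
  obtain ⟨g, hg⟩ : ∃ g : K ⟶ ∐ X.obj, g ≫ telescopeMap X = k ≫ Sigma.ι X.obj 0 :=
    ⟨k ≫ Sigma.ι X.obj 0 ≫ inv (telescopeMap X), by simp⟩
  -- The equation for `g` forces its components recursively; as `K` is compact, only finitely many
  -- of them are nonzero.
  have hgn : ∀ n, g ≫ seqProj X n = k ≫ X.map (homOfLE (Nat.zero_le n)) := by
    intro n
    induction n with
    | zero =>
      rw [← telescopeMap_seqProj_zero, ← Category.assoc, hg, Category.assoc, ι_seqProj_self,
        show X.map (homOfLE (Nat.zero_le 0)) = 𝟙 _ from X.map_id 0]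
    | succ n ih =>
      have h1 := g ≫= telescopeMap_seqProj_succ X n
      rw [← Category.assoc, hg, Category.assoc, ι_seqProj_of_ne X (Nat.succ_ne_zero n).symm,
        comp_zero, Preadditive.comp_sub, ← Category.assoc g, ih, Category.assoc, ← X.map_comp,
        homOfLE_comp] at h1
      exact sub_eq_zero.1 h1.symm
  obtain ⟨s, a, ha⟩ : ∃ (s : Finset ℕ) (a : ∀ i, K ⟶ X.obj i),
      g = ∑ i ∈ s, a i ≫ Sigma.ι X.obj i := hK.exists_sum (isColimitSeqCofan X) g
  obtain ⟨m, hm⟩ := Infinite.exists_notMem_finset s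
  refine ⟨m, ?_⟩
  rw [← hgn, ha, Preadditive.sum_comp]
  refine Finset.sum_eq_zero fun i hi => ?_
  rw [Category.assoc, ι_seqProj_of_ne X (by rintro rfl; exact hm hi), comp_zero]

end Telescope

end Triangulated

/-! ### The t-structure generated by a compact object. -/

section Aisle

set_option linter.unusedSectionVars false

variable {C : Type w'} [Category.{v'} C] [Preadditive C] [HasShift C ℤ]

lemma shifts_singleton_iff {G : C} {S : Set ℤ} {X : C} :
    shifts (ObjectProperty.singleton G) S X ↔ ∃ i ∈ S, Nonempty (X ≅ G⟦i⟧) := by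
  constructor
  · rintro ⟨i, hi, Y, hY, e⟩
    obtain rfl : G = Y := by simpa using hY
    exact ⟨i, hi, e⟩
  · rintro ⟨i, hi, e⟩
    exact ⟨i, hi, G, by simp, e⟩

lemma shifts_singleton_shift {G : C} {S T : Set ℤ} {n : ℤ} (h : ∀ i ∈ S, i + n ∈ T) {X : C}
    (hX : shifts (ObjectProperty.singleton G) S X) :
    shifts (ObjectProperty.singleton G) T (X⟦n⟧) := by
  obtain ⟨i, hi, ⟨e⟩⟩ := shifts_singleton_iff.1 hX
  exact shifts_singleton_iff.2 ⟨i + n, h i hi,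
    ⟨(shiftFunctor C n).mapIso e ≪≫ ((shiftFunctorAdd C i n).app G).symm⟩⟩

lemma shifts_singleton_mono {G : C} {S T : Set ℤ} (h : S ⊆ T) {X : C}
    (hX : shifts (ObjectProperty.singleton G) S X) :
    shifts (ObjectProperty.singleton G) T X := by
  obtain ⟨i, hi, e⟩ := shifts_singleton_iff.1 hX
  exact shifts_singleton_iff.2 ⟨i, h hi, e⟩

lemma hom_eq_zero_of_iso {X X' Y : C} (e : X ≅ X') (h : ∀ f : X' ⟶ Y, f = 0) (f : X ⟶ Y) :
    f = 0 := by
  rw [← cancel_epi e.inv, h (e.inv ≫ f), comp_zero]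

lemma hom_eq_zero_of_iso' {X Y Y' : C} (e : Y ≅ Y') (h : ∀ f : X ⟶ Y', f = 0) (f : X ⟶ Y) :
    f = 0 := by
  rw [← cancel_mono e.hom, h (f ≫ e.hom), zero_comp]

variable [∀ n : ℤ, (shiftFunctor C n).Additive]

/-- The morphisms `X[a] ⟶ Y` vanish if and only if the morphisms `X ⟶ Y[-a]` do. -/
lemma hom_shift_eq_zero_iff {a b : ℤ} (h : a + b = 0) (X Y : C) :
    (∀ f : X⟦a⟧ ⟶ Y, f = 0) ↔ ∀ f : X ⟶ Y⟦b⟧, f = 0 := by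
  constructor
  · intro H f
    rw [← map_eq_zero_iff _ (shiftHomEquiv h X Y).symm.injective]
    exact H _
  · intro H f
    rw [← map_eq_zero_iff _ (shiftHomEquiv h X Y).injective]
    exact H _

lemma hom_shift_shift_eq_zero {X Y : C} {i j k : ℤ} (h : i + j = k)
    (H : ∀ f : X ⟶ Y⟦k⟧, f = 0) (f : X⟦-j⟧ ⟶ Y⟦i⟧) : f = 0 :=
  (hom_shift_eq_zero_iff (neg_add_cancel j) X (Y⟦i⟧)).2
    (hom_eq_zero_of_iso' ((shiftFunctorAdd' C i j k h).symm.app Y) H) f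

variable [HasZeroObject C] [Pretriangulated C]

lemma bigExtensionClosure.mono {P Q : ObjectProperty C} (h : ∀ X, P X → Q X) {X : C}
    (hX : bigExtensionClosure.{u} P X) : bigExtensionClosure.{u} Q X :=
  hX.le_of_le fun X hX => .of_mem (h X hX)

lemma bigExtensionClosure.shift {P Q : ObjectProperty C} {n : ℤ}
    (hP : ∀ X, P X → Q (X⟦n⟧)) {X : C} (h : bigExtensionClosure.{u} P X) :
    bigExtensionClosure.{u} Q (X⟦n⟧) := by
  induction h with
  | of_mem hX => exact .of_mem (hP _ hX)
  | of_isZero hX => exact .of_isZero ((shiftFunctor C n).map_isZero hX)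
  | of_extension T hT _ _ h₁ h₃ =>
    exact .of_extension _ (Triangle.shift_distinguished T hT n) h₁ h₃
  | of_coproduct F c hc _ hF =>
    obtain ⟨hc⟩ := hc
    exact .of_coproduct (fun i => (F i)⟦n⟧) _ ⟨isColimitShiftCofan hc n⟩ hF

lemma bigExtensionClosure.of_small_coproduct {P : ObjectProperty C} {ι : Type t} [Small.{u} ι]
    {F : ι → C} {c : Cofan F} (hc : IsColimit c) (hF : ∀ i, bigExtensionClosure.{u} P (F i)) :
    bigExtensionClosure.{u} P c.pt :=
  .of_coproduct _ _ ⟨Cofan.isColimitEquivOfEquiv (equivShrink.{u} ι).symm c hc⟩ fun _ => hF _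

instance (P : ObjectProperty C) : (bigExtensionClosure.{u} P).ContainsZero where
  exists_zero := ⟨0, isZero_zero C, .of_isZero (isZero_zero C)⟩

lemma bigExtensionClosure.extensionProduct_le (P : ObjectProperty C) :
    ObjectProperty.extensionProduct (bigExtensionClosure.{u} P) (bigExtensionClosure.{u} P) ≤
      bigExtensionClosure.{u} P := by
  rintro X ⟨Y, Z, f, g, h, hT, hY, hZ⟩
  exact .of_extension _ hT hY hZ

/-- The class `[⋃_{i ≥ -n} G[i]⟩`. -/
def aisle (G : C) (n : ℤ) : ObjectProperty C :=
  bigExtensionClosure.{u} (shifts (ObjectProperty.singleton G) (Set.Ici (-n)))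

/-- The class of all objects `X` such that `C(G[i], X) = 0` for all `i > -n`. -/
def coaisle (G : C) (n : ℤ) : ObjectProperty C :=
  fun X => ∀ i : ℤ, -n < i → ∀ f : G⟦i⟧ ⟶ X, f = 0

instance (G : C) (n : ℤ) : (aisle.{u} G n).IsClosedUnderIsomorphisms where
  of_iso e h := bigExtensionClosure_of_iso _ e h

instance (G : C) (n : ℤ) : (coaisle G n).IsClosedUnderIsomorphisms where
  of_iso e h i hi := hom_eq_zero_of_iso' e.symm (h i hi)

lemma shift_mem_aisle (G : C) {i n : ℤ} (h : -n ≤ i) : aisle.{u} G n (G⟦i⟧) :=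
  .of_mem (shifts_singleton_iff.2 ⟨i, h, ⟨Iso.refl _⟩⟩)

lemma aisle_mono (G : C) {m n : ℤ} (h : m ≤ n) {X : C} (hX : aisle.{u} G m X) :
    aisle.{u} G n X :=
  hX.mono fun _ => shifts_singleton_mono (Set.Ici_subset_Ici.2 (by lia))

lemma aisle_shift (G : C) {n a n' : ℤ} (h : a + n' = n) {X : C} (hX : aisle.{u} G n X) :
    aisle.{u} G n' (X⟦a⟧) :=
  bigExtensionClosure.shift
    (fun _ => shifts_singleton_shift fun i (hi : -n ≤ i) => show -n' ≤ i + a by lia) hX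

lemma coaisle_shift (G : C) {n a n' : ℤ} (h : a + n' = n) {X : C} (hX : coaisle G n X) :
    coaisle G n' (X⟦a⟧) := by
  intro i hi
  rw [← hom_shift_eq_zero_iff (neg_add_cancel a)]
  exact hom_eq_zero_of_iso ((shiftFunctorAdd' C i (-a) (i - a) (by lia)).symm.app G)
    (hX (i - a) (by lia))

lemma aisle.hom_eq_zero {G : C} {n m : ℤ} (h : n < m) {X Y : C} (hX : aisle.{u} G n X)
    (hY : coaisle G m Y) (f : X ⟶ Y) : f = 0 := by
  refine bigExtensionClosure.hom_eq_zero (fun X hX => ?_) hX f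
  obtain ⟨i, hi, ⟨e⟩⟩ := shifts_singleton_iff.1 hX
  have hi' : -n ≤ i := hi
  exact hom_eq_zero_of_iso e (hY i (by lia))

section Generation

variable [HasCoproducts.{u} C] {G : C}

/-- A coproduct of shifts of `G` through which a given class of morphisms factors. -/
lemma exists_cover (hsmall : ∀ (i : ℤ) (X : C), Small.{u} (G⟦i⟧ ⟶ X)) (X : C) (S : Set ℤ)
    (p : ∀ i : ℤ, (G⟦i⟧ ⟶ X) → Prop) :
    ∃ (E : C) (e : E ⟶ X),
      bigExtensionClosure.{u} (shifts (ObjectProperty.singleton G) S) E ∧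
      (∀ i ∈ S, ∀ k : G⟦i⟧ ⟶ X, p i k → ∃ h, k = h ≫ e) ∧
      ∀ (Y : C) (f : X ⟶ Y), (∀ i ∈ S, ∀ k : G⟦i⟧ ⟶ X, p i k → k ≫ f = 0) → e ≫ f = 0 := by
  let J := Σ i : S, {k : G⟦i.1⟧ ⟶ X // p _ k}
  have : Small.{u} J := by
    have := fun i : S => hsmall i.1 X
    infer_instance
  let σ := (equivShrink.{u} J).symm
  let Gσ : Shrink.{u} J → C := fun j => G⟦(σ j).1.1⟧
  refine ⟨∐ Gσ, Sigma.desc fun j => (σ j).2.1, ?_, ?_, ?_⟩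
  · exact .of_coproduct Gσ _ ⟨coproductIsCoproduct Gσ⟩ fun j => .of_mem
      (shifts_singleton_iff.2 ⟨_, (σ j).1.2, ⟨Iso.refl _⟩⟩)
  · intro i hi k hk
    have H : ∀ x : J, ∃ h : G⟦x.1.1⟧ ⟶ ∐ Gσ, x.2.1 = h ≫ Sigma.desc fun j => (σ j).2.1 := by
      intro x
      obtain ⟨j, rfl⟩ := σ.surjective x
      exact ⟨Sigma.ι Gσ j, by simp⟩
    exact H ⟨⟨i, hi⟩, k, hk⟩
  · intro Y f hf
    refine Sigma.hom_ext _ _ fun j => ?_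
    rw [comp_zero, ← Category.assoc, Sigma.ι_desc]
    exact hf _ (σ j).1.2 _ (σ j).2.2

/-- `B'` is the cone of a cover of the kernel of `b`. The bound -1 is as low as possible with the
shift of the cover still in the aisle, and as low as needed: a morphism from `G[i]`, i ≥ 0, to the
cone of `b` has its boundary in Hom(G[i - 1], B). -/
lemma exists_aisle_step (hsmall : ∀ (i : ℤ) (X : C), Small.{u} (G⟦i⟧ ⟶ X)) {X B : C}
    (b : B ⟶ X) (hB : aisle.{u} G 0 B) :
    ∃ (B' : C) (b' : B' ⟶ X) (φ : B ⟶ B'), aisle.{u} G 0 B' ∧ φ ≫ b' = b ∧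
      ∀ (i : ℤ), -1 ≤ i → ∀ k : G⟦i⟧ ⟶ B, k ≫ b = 0 → k ≫ φ = 0 := by
  obtain ⟨E, e, hE, h1, h2⟩ := exists_cover hsmall B (Set.Ici (-1)) fun i k => k ≫ b = 0
  obtain ⟨B', φ, δ, hT⟩ := distinguished_cocone_triangle e
  have heφ : e ≫ φ = 0 := comp_distTriang_mor_zero₁₂ _ hT
  obtain ⟨b', hb'⟩ : ∃ b' : B' ⟶ X, b = φ ≫ b' :=
    Triangle.yoneda_exact₂ _ hT b (h2 X b fun i _ k hk => hk)
  refine ⟨B', b', φ, ?_, hb'.symm, ?_⟩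
  · have hE' : aisle.{u} G 0 (E⟦(1 : ℤ)⟧) := aisle_shift G (n := 1) (by simp) hE
    exact bigExtensionClosure.of_extension _ (rot_of_distTriang _ hT) hB hE'
  · intro i hi k hk
    obtain ⟨h, rfl⟩ := h1 i hi k hk
    rw [Category.assoc, heφ, comp_zero]

/-- Truncation triangles for the aisle generated by a compact object. -/
theorem exists_aisle_triangle (hG : IsCompactObj.{u} G)
    (hsmall : ∀ (i : ℤ) (X : C), Small.{u} (G⟦i⟧ ⟶ X)) (X : C) :
    ∃ (B Y : C) (_ : aisle.{u} G 0 B) (_ : coaisle G 1 Y)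
      (f : B ⟶ X) (g : X ⟶ Y) (h : Y ⟶ B⟦(1 : ℤ)⟧), Triangle.mk f g h ∈ distTriang C := by
  have : HasCoproductsOfShape ℕ C := (hasCoproducts_shrink.{0, u} (C := C)) ℕ
  obtain ⟨B₀, b₀, hB₀, h₀, -⟩ := exists_cover hsmall X (Set.Ici (-0)) fun _ _ => True
  let T := {p : Over X // aisle.{u} G 0 p.left}
  have hstep : ∀ p : T, ∃ (q : T) (φ : p.1 ⟶ q.1), ∀ (i : ℤ), -1 ≤ i → ∀ k : G⟦i⟧ ⟶ p.1.left,
      k ≫ p.1.hom = 0 → k ≫ φ.left = 0 := by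
    rintro ⟨p, hp⟩
    obtain ⟨B', b', φ, h1, h2, h3⟩ := exists_aisle_step hsmall p.hom hp
    exact ⟨⟨Over.mk b', h1⟩, Over.homMk φ h2, h3⟩
  choose next φ hφ using hstep
  let seq : ℕ → T := fun n => Nat.rec ⟨Over.mk b₀, hB₀⟩ (fun _ p => next p) n
  let S : ℕ ⥤ Over X := Functor.ofSequence (X := fun n => (seq n).1) fun n => φ (seq n)
  let F : ℕ ⥤ C := S ⋙ Over.forget X
  let b : ∀ n, F.obj n ⟶ X := fun n => (S.obj n).hom
  have hFb : ∀ n, F.map (homOfLE n.le_succ) ≫ b (n + 1) = b n := fun n =>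
    Over.w (S.map (homOfLE n.le_succ))
  have hkill : ∀ n (i : ℤ), -1 ≤ i → ∀ k : G⟦i⟧ ⟶ F.obj n, k ≫ b n = 0 →
      k ≫ F.map (homOfLE n.le_succ) = 0 := by
    intro n i hi k hk
    have : S.map (homOfLE n.le_succ) = φ (seq n) := Functor.ofSequence_map_homOfLE_succ _ n
    have h' : F.map (homOfLE n.le_succ) = (φ (seq n)).left := congrArg CommaMorphism.left this
    rw [h']
    exact hφ (seq n) i hi k hk
  have hF : ∀ n, aisle.{u} G 0 (F.obj n) := fun n => (seq n).2
  obtain ⟨B, q, δ, hT⟩ := distinguished_cocone_triangle (telescopeMap F)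
  have hsum : aisle.{u} G 0 (∐ F.obj) :=
    bigExtensionClosure.of_small_coproduct (isColimitSeqCofan F) hF
  have hB : aisle.{u} G 0 B := bigExtensionClosure.of_extension _ (rot_of_distTriang _ hT) hsum
    (aisle_mono G (by simp) (aisle_shift G (n' := -1) (a := 1) (by simp) hsum))
  have hb : telescopeMap F ≫ Sigma.desc b = 0 := Sigma.hom_ext _ _ fun n => by
    rw [← Category.assoc, ι_telescopeMap, Preadditive.sub_comp, Sigma.ι_desc, Category.assoc,
      Sigma.ι_desc, hFb, sub_self, comp_zero]
  obtain ⟨b', hb'⟩ : ∃ b' : B ⟶ X, Sigma.desc b = q ≫ b' := Triangle.yoneda_exact₂ _ hT _ hb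
  have hbn : ∀ n, Sigma.ι F.obj n ≫ q ≫ b' = b n := fun n => by rw [← hb', Sigma.ι_desc]
  obtain ⟨Y, g, h, hT'⟩ := distinguished_cocone_triangle b'
  have hb'g : b' ≫ g = 0 := comp_distTriang_mor_zero₁₂ _ hT'
  have hhb' : h ≫ b'⟦(1 : ℤ)⟧' = 0 := comp_distTriang_mor_zero₃₁ _ hT'
  refine ⟨B, Y, hB, ?_, b', g, h, hT'⟩
  have hq : telescopeMap F ≫ q = 0 := comp_distTriang_mor_zero₁₂ _ hT
  -- Such a `k` comes from some stage, and the next stage kills it.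
  have hinj : ∀ i : ℤ, -1 ≤ i → ∀ k : G⟦i⟧ ⟶ B, k ≫ b' = 0 → k = 0 := by
    intro i hi k hk
    obtain ⟨n, l, rfl⟩ := (hG.shift i).exists_lift_hocolim F q δ hT k
    rw [Category.assoc, Category.assoc, hbn] at hk
    rw [ι_comp_eq_of_telescopeMap_comp F q hq n.le_succ, ← Category.assoc, hkill n i hi l hk,
      zero_comp]
  intro i hi k
  have hkh : k ≫ h = 0 := by
    refine eq_zero_of_comp_shift b' (fun l hl => ?_) (k ≫ h)
      (by rw [Category.assoc, hhb', comp_zero])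
    let e := (shiftFunctorAdd' C i (-1) (i - 1) (by lia)).app G
    rw [← cancel_epi e.hom, comp_zero]
    refine hinj (i - 1) (by lia) _ ?_
    rw [Category.assoc, hl, comp_zero]
  obtain ⟨k', rfl⟩ : ∃ k', k = k' ≫ g := Triangle.coyoneda_exact₃ _ hT' k hkh
  -- The lift of `k` to `X` factors through the initial cover `B₀`, which maps to zero in `Y`.
  obtain ⟨k'', hk''⟩ := h₀ i (show -0 ≤ i by lia) k' trivial
  have hbg : b 0 ≫ g = 0 := by
    rw [← hbn, Category.assoc, Category.assoc, hb'g, comp_zero, comp_zero]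
  have hbg' : b₀ ≫ g = 0 := hbg
  rw [hk'', Category.assoc, hbg', comp_zero]

/-- The t-structure generated by a compact object. -/
def generatedTStructure (hG : IsCompactObj.{u} G)
    (hsmall : ∀ (i : ℤ) (X : C), Small.{u} (G⟦i⟧ ⟶ X)) : Triangulated.TStructure C where
  le n := aisle.{u} G n
  ge n := coaisle G n
  le_shift _ _ _ h _ hX := aisle_shift G h hX
  ge_shift _ _ _ h _ hX := coaisle_shift G h hX
  zero' _ _ f hX hY := aisle.hom_eq_zero zero_lt_one hX hY f
  le_zero_le _ hX := aisle_mono G zero_le_one hX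
  ge_one_le _ hX i hi := hX i (by lia)
  exists_triangle_zero_one X := exists_aisle_triangle hG hsmall X

end Generation

end Aisle

/-! ### Weak approximability from weak negativity; boundedness of compact objects. -/

section Approximation

set_option linter.unusedSectionVars false

variable {C : Type w'} [Category.{v'} C] [Preadditive C] [HasShift C ℤ]
  [∀ n : ℤ, (shiftFunctor C n).Additive] [HasZeroObject C] [Pretriangulated C]

/-- A weakly negative compact object has no morphisms to the second shift of its aisle. -/
lemma hom_aisle_eq_zero {G : C} (hG : IsCompactObj.{u} G)
    (hneg : ∀ i : ℤ, 1 < i → ∀ f : G ⟶ G⟦i⟧, f = 0) {j n : ℤ} (h : 1 < -n - j) {X : C}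
    (hX : aisle.{u} G n X) (f : G⟦j⟧ ⟶ X) : f = 0 := by
  refine (hG.shift j).hom_eq_zero (fun Y hY => ?_) hX f
  obtain ⟨i, hi, ⟨e⟩⟩ := shifts_singleton_iff.1 hY
  have hi' : -n ≤ i := hi
  refine hom_eq_zero_of_iso' e ?_
  obtain ⟨j, rfl⟩ : ∃ k, j = -k := ⟨-j, by simp⟩
  exact hom_shift_shift_eq_zero rfl (hneg (i + j) (by lia))

/-- Extensions in the opposite order can be swapped if there are no connecting morphisms. -/
lemma extensionProduct_swap {P Q : ObjectProperty C}
    (h : ∀ X Y, P X → Q Y → ∀ f : X ⟶ Y⟦(1 : ℤ)⟧, f = 0) :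
    ObjectProperty.extensionProduct Q P ≤ ObjectProperty.extensionProduct P Q := by
  rintro X ⟨Y, Z, f, g, δ, hT, hY, hZ⟩
  -- A vanishing connecting morphism splits the triangle, and the direct sum can be read in either
  -- order.
  obtain ⟨e, -, -⟩ := exists_iso_binaryBiproduct_of_distTriang _ hT (h Z Y hZ hY δ)
  refine ObjectProperty.prop_of_iso _ (biprod.braiding Z Y ≪≫ e.symm) ?_
  exact ⟨Z, Y, _, _, _, binaryBiproductTriangle_distinguished Z Y, hZ, hY⟩

/-- By associativity of ⋆ and the swap, P ⋆ (Q ⋆ P) ⋆ Q ⊆ (P ⋆ P) ⋆ (Q ⋆ Q) ⊆ P ⋆ Q. -/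
lemma extensionProduct_extension_closed [IsTriangulated C] {P Q : ObjectProperty C}
    (hP : ObjectProperty.extensionProduct P P ≤ P) (hQ : ObjectProperty.extensionProduct Q Q ≤ Q)
    (h : ∀ X Y, P X → Q Y → ∀ f : X ⟶ Y⟦(1 : ℤ)⟧, f = 0) :
    ObjectProperty.extensionProduct (ObjectProperty.extensionProduct P Q)
      (ObjectProperty.extensionProduct P Q) ≤ ObjectProperty.extensionProduct P Q := by
  rw [ObjectProperty.extensionProduct_assoc, ← ObjectProperty.extensionProduct_assoc Q P Q]
  calc _ ≤ ObjectProperty.extensionProduct P (ObjectProperty.extensionProduct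
        (ObjectProperty.extensionProduct P Q) Q) :=
        ObjectProperty.monotone_extensionProduct_right _
          (ObjectProperty.monotone_extensionProduct_left _ (extensionProduct_swap h))
    _ = ObjectProperty.extensionProduct (ObjectProperty.extensionProduct P P)
        (ObjectProperty.extensionProduct Q Q) := by
        rw [ObjectProperty.extensionProduct_assoc P Q Q, ← ObjectProperty.extensionProduct_assoc]
    _ ≤ _ := (ObjectProperty.monotone_extensionProduct_left _ hP).trans
        (ObjectProperty.monotone_extensionProduct_right _ hQ)

lemma extensionProduct_of_isColimit [HasCoproducts.{u} C] {P Q : ObjectProperty C}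
    {ι : Type u} {F : ι → C} {c : Cofan F} (hc : IsColimit c)
    (hF : ∀ i, ObjectProperty.extensionProduct (bigExtensionClosure.{u} P)
      (bigExtensionClosure.{u} Q) (F i)) :
    ObjectProperty.extensionProduct (bigExtensionClosure.{u} P)
      (bigExtensionClosure.{u} Q) c.pt := by
  choose Y Z f g h hT hY hZ using hF
  obtain ⟨f', g', h', hT', -⟩ := exists_distTriang_of_isColimit
    (fun i => Triangle.mk (f i) (g i) (h i)) hT (coproductIsCoproduct Y) hc
    (coproductIsCoproduct Z)
  exact ⟨_, _, f', g', h', hT', .of_coproduct _ _ ⟨coproductIsCoproduct Y⟩ hY,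
    .of_coproduct _ _ ⟨coproductIsCoproduct Z⟩ hZ⟩

/-- Every object of the aisle of a weakly negative compact object is an extension of an object
of the shifted aisle by an object of the big extension-closure of `G`. -/
theorem aisle_le_extensionProduct [IsTriangulated C] [HasCoproducts.{u} C] {G : C}
    (hG : IsCompactObj.{u} G) (hneg : ∀ i : ℤ, 1 < i → ∀ f : G ⟶ G⟦i⟧, f = 0) :
    aisle.{u} G 0 ≤ ObjectProperty.extensionProduct
      (bigExtensionClosure.{u} (shifts (ObjectProperty.singleton G) {0})) (aisle.{u} G (-1)) := by
  -- `Y[1]` is built from `G[i]` with i ≥ 2, the range covered by weak negativity.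
  have hzero : ∀ X Y, bigExtensionClosure.{u} (shifts (ObjectProperty.singleton G) {0}) X →
      aisle.{u} G (-1) Y → ∀ f : X ⟶ Y⟦(1 : ℤ)⟧, f = 0 := by
    intro X Y hX hY f
    refine hX.hom_eq_zero (fun X hX f => ?_) f
    obtain ⟨i, hi, ⟨e⟩⟩ := shifts_singleton_iff.1 hX
    obtain rfl : i = 0 := hi
    exact hom_eq_zero_of_iso e (hom_aisle_eq_zero hG hneg (n := -2) (by simp)
      (aisle_shift G (by simp) hY)) f
  have : (aisle.{u} G (-1)).ContainsZero :=
    inferInstanceAs (bigExtensionClosure.{u} _).ContainsZero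
  intro X hX
  induction hX with
  | of_mem hX =>
    obtain ⟨i, hi, ⟨e⟩⟩ := shifts_singleton_iff.1 hX
    have hi' : -0 ≤ i := hi
    refine ObjectProperty.prop_of_iso _ e.symm ?_
    by_cases h : i = 0
    · subst h
      exact ObjectProperty.le_extensionProduct_left _ _
        (.of_mem (shifts_singleton_iff.2 ⟨0, rfl, ⟨Iso.refl _⟩⟩))
    · exact ObjectProperty.le_extensionProduct_right _ _ (shift_mem_aisle G (by lia))
  | of_isZero hX => exact ObjectProperty.le_extensionProduct_left _ _ (.of_isZero hX)
  | of_extension T hT _ _ h₁ h₃ =>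
    exact extensionProduct_extension_closed (bigExtensionClosure.extensionProduct_le _)
      (bigExtensionClosure.extensionProduct_le _) hzero _
      ⟨_, _, T.mor₁, T.mor₂, T.mor₃, hT, h₁, h₃⟩
  | of_coproduct F c hc _ hF =>
    obtain ⟨hc⟩ := hc
    exact extensionProduct_of_isColimit hc hF

/-- A category with coproducts that is compactly generated by a weakly negative object is weakly
approximable. -/
theorem isWeaklyApproximable_of_isWeaklyNegative [IsTriangulated C] [HasCoproducts.{u} C] {G : C}
    (hG : CompactlyGenerates.{u} (ObjectProperty.singleton G))
    (hneg : IsWeaklyNegative (ObjectProperty.singleton G))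
    (hsmall : ∀ (i : ℤ) (X : C), Small.{u} (G⟦i⟧ ⟶ X)) : IsWeaklyApproximable.{u} C := by
  have hG' : IsCompactObj.{u} G := hG.1 G (by simp)
  have hneg' : ∀ i : ℤ, 1 < i → ∀ f : G ⟶ G⟦i⟧, f = 0 := hneg G G (by simp) (by simp)
  -- The constant is A = 2: Hom(G[-A], G[i]) has to vanish for all i ≥ 0, and weak negativity asks
  -- for i + A > 1.
  refine ⟨inferInstance, G, generatedTStructure hG' hsmall, 2, two_pos, hG,
    shift_mem_aisle G (by simp), fun F hF => ?_, fun F hF => ?_⟩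
  · exact hom_aisle_eq_zero hG' hneg' (by simp) hF
  · obtain ⟨Y, Z, f, g, h, hT, hY, hZ⟩ := aisle_le_extensionProduct hG' hneg' F hF
    refine ⟨Y, Z, f, g, h, hT, ObjectProperty.le_retractClosure _ _ (hY.mono fun X hX => ?_), hZ⟩
    exact shifts_singleton_mono (by rintro i rfl; simp) hX

/-- Compact objects are bounded above for every t-structure whose aisle contains a shift of a
compact generator. -/
theorem IsCompactObj.exists_le [HasCoproducts.{u} C] [IsTriangulated C] {G : C}
    (hG : CompactlyGenerates.{u} (ObjectProperty.singleton G))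
    (t : Triangulated.TStructure C) {a : ℤ} (ha : t.le 0 (G⟦a⟧)) {K : C}
    (hK : IsCompactObj.{u} K) : ∃ m, t.le m K := by
  have : HasCoproductsOfShape ℕ C := (hasCoproducts_shrink.{0, u} (C := C)) ℕ
  -- Truncations τ^{≥1}, τ^{≥2}, ... applied successively to `K` give a sequence in which every
  -- morphism from a shift of `G` dies, because that shift is bounded above.
  have hstep : ∀ (n : ℕ) (X : C), ∃ (Y : C) (φ : X ⟶ Y), t.ge (n + 1) Y ∧
      ∀ Z, t.ge (n + 1) Z → ∀ f : X ⟶ Z, ∃ g, f = φ ≫ g := by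
    intro n X
    obtain ⟨L, Y, hL, hY, f, g, h, hT⟩ := t.exists_triangle X n (n + 1) rfl
    refine ⟨Y, g, hY, fun Z hZ k => Triangle.yoneda_exact₂ _ hT k ?_⟩
    exact t.zero_of_isLE_of_isGE _ n (n + 1) (by lia) ⟨hL⟩ ⟨hZ⟩
  choose next φ hge hφ using hstep
  let seq : ℕ → C := fun n => Nat.rec K (fun n X => next n X) n
  let X : ℕ ⥤ C := Functor.ofSequence (X := seq) fun n => φ n (seq n)
  have hXge : ∀ n : ℕ, t.ge (n + 1) (X.obj (n + 1)) := fun n => hge n (seq n)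
  have hfac : ∀ (n : ℕ) (Z : C), t.ge n Z → ∀ f : K ⟶ Z, ∃ g,
      f = X.map (homOfLE (Nat.zero_le n)) ≫ g := by
    intro n
    induction n with
    | zero =>
      intro Z _ f
      refine ⟨f, ?_⟩
      rw [show X.map (homOfLE (Nat.zero_le 0)) = 𝟙 _ from X.map_id 0]
      exact (Category.id_comp f).symm
    | succ n ih =>
      intro Z hZ f
      have hZ' : t.ge (n + 1) Z := by exact_mod_cast hZ
      obtain ⟨g, rfl⟩ := ih Z (t.ge_antitone (by simp) _ hZ') f
      obtain ⟨g', rfl⟩ := hφ n (seq n) Z hZ' g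
      refine ⟨g', ?_⟩
      have h1 : X.map (homOfLE n.le_succ) = φ n (seq n) := Functor.ofSequence_map_homOfLE_succ _ n
      rw [← homOfLE_comp (Nat.zero_le n) n.le_succ, X.map_comp, h1]
      exact (Category.assoc _ _ _).symm
  have hG' : IsCompactObj.{u} G := hG.1 G (by simp)
  obtain ⟨m, hm⟩ := hG'.exists_comp_map_eq_zero X hG.2 (fun i n f => by
    let m : ℕ := max n (a - i).toNat + 1
    refine ⟨m, by lia, ?_⟩
    have h1 : t.IsLE (G⟦i⟧) (a - i) := by
      have : t.IsLE (G⟦a⟧) 0 := ⟨ha⟩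
      have h2 := t.isLE_shift (G⟦a⟧) 0 (i - a) (a - i)
      exact t.isLE_of_iso (show G⟦a⟧⟦i - a⟧ ≅ G⟦i⟧ from
        (shiftFunctorAdd' C a (i - a) i (by lia)).symm.app G) _
    refine t.zero_of_isLE_of_isGE _ (a - i) (max n (a - i).toNat + 1 : ℕ) (by lia) h1 ⟨?_⟩
    exact_mod_cast hXge (max n (a - i).toNat)) hK (𝟙 K)
  -- `K ⟶ X.obj m` is zero, and every morphism from `K` to an object of `t.ge m` factors through it.
  refine ⟨m - 1, ?_⟩
  have : t.IsLE K (m - 1) := by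
    rw [t.isLE_iff_orthogonal (m - 1) m (by lia)]
    intro Z f hZ
    obtain ⟨g, rfl⟩ := hfac m Z hZ.ge f
    have hm' : X.map (homOfLE (Nat.zero_le m)) = 0 := (Category.id_comp _).symm.trans hm
    rw [hm']
    exact zero_comp
  exact this.le

end Approximation

/-! ### Torsion exponents, approximation towers and the failure of approximability. -/

section NotApproximable

set_option linter.unusedSectionVars false

variable {C : Type w'} [Category.{v'} C] [Preadditive C]

lemma nsmul_eq_zero_of_nsmul_id {X Y : C} {q : ℕ} (h : q • 𝟙 X = 0) (f : X ⟶ Y) : q • f = 0 := by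
  rw [← Category.id_comp f, ← Preadditive.nsmul_comp, h, zero_comp]

lemma nsmul_eq_zero_of_nsmul_id' {X Y : C} {q : ℕ} (h : q • 𝟙 Y = 0) (f : X ⟶ Y) : q • f = 0 := by
  rw [← Category.comp_id f, ← Preadditive.comp_nsmul, h, comp_zero]

lemma nsmul_id_of_retract {X Y : C} (r : Retract X Y) {q : ℕ} (h : q • 𝟙 Y = 0) :
    q • 𝟙 X = 0 := by
  rw [← r.retract, ← Preadditive.nsmul_comp, nsmul_eq_zero_of_nsmul_id' h, zero_comp]

lemma nsmul_id_of_iso {X Y : C} (e : X ≅ Y) {q : ℕ} (h : q • 𝟙 Y = 0) : q • 𝟙 X = 0 := by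
  rw [← e.hom_inv_id, ← Preadditive.nsmul_comp, nsmul_eq_zero_of_nsmul_id' h, zero_comp]

variable [HasShift C ℤ] [∀ n : ℤ, (shiftFunctor C n).Additive]

lemma nsmul_id_shift {X : C} {q : ℕ} (h : q • 𝟙 X = 0) (n : ℤ) : q • 𝟙 (X⟦n⟧) = 0 := by
  rw [← (shiftFunctor C n).map_id, ← Functor.map_nsmul, h, Functor.map_zero]

lemma nsmul_id_of_shift {X : C} {q : ℕ} {n : ℤ} (h : q • 𝟙 (X⟦n⟧) = 0) : q • 𝟙 X = 0 := by
  apply (shiftFunctor C n).map_injective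
  rw [Functor.map_nsmul, CategoryTheory.Functor.map_id, h, Functor.map_zero]

lemma nsmul_id_of_coproducts {P : ObjectProperty C} {q : ℕ} (hP : ∀ X, P X → q • 𝟙 X = 0) {X : C}
    (hX : coproducts.{u} P X) : q • 𝟙 X = 0 := by
  obtain ⟨ι, ⟨c⟩⟩ := hX
  refine c.isColimit.hom_ext fun i => ?_
  rw [comp_zero, Preadditive.comp_nsmul]
  exact nsmul_eq_zero_of_nsmul_id (hP _ (c.prop_diag_obj i)) _

variable [HasZeroObject C] [Pretriangulated C]

/-- Multiplication by `b` on the middle term vanishes in the third term, so it factors through the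
first, where `a` kills it. -/
lemma nsmul_id_of_extension {T : Triangle C} (hT : T ∈ distTriang C) {a b : ℕ}
    (h₁ : a • 𝟙 T.obj₁ = 0) (h₃ : b • 𝟙 T.obj₃ = 0) : (a * b) • 𝟙 T.obj₂ = 0 := by
  obtain ⟨f, hf⟩ := Triangle.coyoneda_exact₂ T hT (b • 𝟙 T.obj₂) (by
    rw [Preadditive.nsmul_comp, Category.id_comp, nsmul_eq_zero_of_nsmul_id' h₃])
  rw [mul_smul, hf, ← Preadditive.nsmul_comp, nsmul_eq_zero_of_nsmul_id' h₁, zero_comp]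

lemma nsmul_id_of_extensionProductIter {P : ObjectProperty C} {q : ℕ}
    (hP : ∀ X, P X → q • 𝟙 X = 0) (n : ℕ) {X : C} (hX : P.extensionProductIter n X) :
    (q ^ (n + 1)) • 𝟙 X = 0 := by
  induction n generalizing X with
  | zero => simpa using hP X hX
  | succ n ih =>
    rw [ObjectProperty.extensionProductIter_succ] at hX
    obtain ⟨Y, Z, f, g, h, hT, hY, hZ⟩ := hX
    rw [pow_succ']
    exact nsmul_id_of_extension hT (hP _ hY) (ih hZ)

/-- An object built from `n` layers of coproducts of shifts of a `q`-torsion object is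
`q ^ n`-torsion. -/
theorem generatedIn.nsmul_id {G : C} {q : ℕ} (hG : q • 𝟙 G = 0) {n : ℕ} {a b : ℤ} {E : C}
    (hE : generatedIn.{u} G n a b E) : (q ^ n) • 𝟙 E = 0 := by
  obtain ⟨E', hE', ⟨r⟩⟩ := hE
  refine nsmul_id_of_retract r ?_
  match n, hE' with
  | 0, hE' => exact IsZero.eq_of_src hE' _ _
  | n + 1, hE' =>
    refine nsmul_id_of_extensionProductIter (fun X => nsmul_id_of_coproducts fun Y hY => ?_) n hE'
    obtain ⟨i, -, ⟨e⟩⟩ := shifts_singleton_iff.1 hY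
    exact nsmul_id_of_iso e (nsmul_id_shift hG i)

lemma bigExtensionClosure.of_coproducts {P : ObjectProperty C} {X : C}
    (hX : coproducts.{u} P X) : bigExtensionClosure.{u} P X := by
  obtain ⟨ι, ⟨c⟩⟩ := hX
  exact .of_coproduct _ _ ⟨(IsColimit.precomposeInvEquiv
    (Discrete.natIsoFunctor (F := c.diag)) (Cocone.mk X c.ι)).symm c.isColimit⟩
    fun i => .of_mem (c.prop_diag_obj ⟨i⟩)

lemma bigExtensionClosure.of_extensionProductIter {P Q : ObjectProperty C}
    (h : ∀ X, P X → bigExtensionClosure.{u} Q X) (n : ℕ) {X : C}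
    (hX : P.extensionProductIter n X) : bigExtensionClosure.{u} Q X := by
  induction n generalizing X with
  | zero => exact h X hX
  | succ n ih =>
    rw [ObjectProperty.extensionProductIter_succ] at hX
    obtain ⟨Y, Z, f, g, δ, hT, hY, hZ⟩ := hX
    exact .of_extension _ hT (h _ hY) (ih hZ)

lemma bigExtensionClosure.of_coprodIter {P : ObjectProperty C} {n : ℕ} {X : C}
    (hX : coprodIter.{u} P n X) : bigExtensionClosure.{u} P X :=
  match n, hX with
  | 0, hX => .of_isZero hX
  | n + 1, hX => .of_extensionProductIter (fun _ => .of_coproducts) n hX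

/-- If `C(K, G[i])` vanishes for large `i`, then so does `C(K, E[i])`, uniformly in the objects
`E` built from `G[a, b]`. -/
lemma generatedIn.hom_eq_zero {G K : C} (hK : IsCompactObj.{u} K) {m : ℤ}
    (hm : ∀ i, m ≤ i → ∀ f : K ⟶ G⟦i⟧, f = 0) {n : ℕ} {a b : ℤ} {E : C}
    (hE : generatedIn.{u} G n a b E) {i : ℤ} (hi : m + b ≤ i) (f : K ⟶ E⟦i⟧) : f = 0 := by
  obtain ⟨E', hE', ⟨r⟩⟩ := hE
  suffices ∀ f : K ⟶ E'⟦i⟧, f = 0 by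
    rw [← Category.comp_id f, ← (shiftFunctor C i).map_id, ← r.retract, Functor.map_comp,
      ← Category.assoc, this (f ≫ _), zero_comp]
  rw [← hom_shift_eq_zero_iff (neg_add_cancel i)]
  refine (hK.shift (-i)).hom_eq_zero (fun X hX => ?_) (bigExtensionClosure.of_coprodIter hE')
  obtain ⟨j, hj, ⟨e⟩⟩ := shifts_singleton_iff.1 hX
  have hj' : a ≤ -j ∧ -j ≤ b := hj
  exact hom_eq_zero_of_iso' e (hom_shift_shift_eq_zero rfl (hm _ (by lia)))

/-- Multiplication by `p` gives the sequence K → K → K → ..., in which each morphism from a shift of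
`G` dies after one step. -/
lemma exists_pow_nsmul_id [HasCoproducts.{u} C] {G : C}
    (hG : CompactlyGenerates.{u} (ObjectProperty.singleton G)) {p : ℕ} (hp : p • 𝟙 G = 0) {K : C}
    (hK : IsCompactObj.{u} K) : ∃ k, (p ^ k) • 𝟙 K = 0 := by
  have : HasCoproductsOfShape ℕ C := (hasCoproducts_shrink.{0, u} (C := C)) ℕ
  let X : ℕ ⥤ C := Functor.ofSequence (X := fun _ => K) fun _ => p • 𝟙 K
  have hX : ∀ n : ℕ, X.map (homOfLE n.le_succ) = p • 𝟙 K := fun n =>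
    Functor.ofSequence_map_homOfLE_succ _ n
  have hX' : ∀ n, X.map (homOfLE (Nat.zero_le n)) = (p ^ n) • 𝟙 K := by
    intro n
    induction n with
    | zero => exact (X.map_id 0).trans (by simp; rfl)
    | succ n ih =>
      rw [← homOfLE_comp (Nat.zero_le n) n.le_succ, X.map_comp, hX, ih]
      exact (Preadditive.comp_nsmul ((p ^ n) • 𝟙 K) (𝟙 K) p).trans (by
        rw [Category.comp_id, ← mul_smul, pow_succ'])
  obtain ⟨m, hm⟩ := (hG.1 G (by simp)).exists_comp_map_eq_zero X hG.2 (fun i n a => by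
    refine ⟨n + 1, n.le_succ, ?_⟩
    rw [hX]
    exact (Preadditive.comp_nsmul a (𝟙 K) p).trans
      (nsmul_eq_zero_of_nsmul_id (nsmul_id_shift hp i) _)) hK (𝟙 K)
  exact ⟨m, (hX' m).symm.trans ((Category.id_comp _).symm.trans hm)⟩

/-- Iterated approximation of an object of the aisle of a t-structure. -/
lemma exists_tower (t : Triangulated.TStructure C) {P : ObjectProperty C}
    (hP : ∀ F : C, t.le 0 F → HasApproximation P (t.le (-1)) F) {F : C} (hF : t.le 0 F) :
    ∃ (X : ℕ ⥤ C) (_ : X.obj 0 ≅ F), (∀ n : ℕ, t.le (-n) (X.obj n)) ∧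
      ∀ (n : ℕ) (K : C) (f : K ⟶ X.obj n), f ≫ X.map (homOfLE n.le_succ) = 0 →
        ∃ (E : C) (_ : P E) (g : K ⟶ E⟦(n : ℤ)⟧) (h : E⟦(n : ℤ)⟧ ⟶ X.obj n), f = g ≫ h := by
  have hstep : ∀ (n : ℕ) (D : {D : C // t.le (-n) D}),
      ∃ (D' : {D : C // t.le (-(n + 1 : ℕ)) D}) (φ : D.1 ⟶ D'.1),
        ∀ (K : C) (f : K ⟶ D.1), f ≫ φ = 0 →
        ∃ (E : C) (_ : P E) (g : K ⟶ E⟦(n : ℤ)⟧) (h : E⟦(n : ℤ)⟧ ⟶ D.1), f = g ≫ h := by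
    rintro n ⟨D, hD⟩
    obtain ⟨E, D', f, g, h, hT, hE, hD'⟩ := hP (D⟦(-n : ℤ)⟧) (t.le_shift (-n) (-n) 0 (by simp) D hD)
    have hT' := Triangle.shift_distinguished _ hT (n : ℤ)
    let e : D⟦(-n : ℤ)⟧⟦(n : ℤ)⟧ ≅ D := (shiftFunctorCompIsoId C (-n : ℤ) n (by simp)).app D
    refine ⟨⟨D'⟦(n : ℤ)⟧, t.le_shift (-1) n _ (by simp) D' hD'⟩, e.inv ≫ g⟦(n : ℤ)⟧', ?_⟩
    intro K k hk
    -- Shifting a triangle by `n` multiplies its morphisms by the sign (-1)^n.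
    have hk' : (k ≫ e.inv) ≫ ((n : ℤ).negOnePow • g⟦(n : ℤ)⟧') = 0 := by
      rw [Linear.comp_units_smul, Category.assoc, hk, smul_zero]
    obtain ⟨l, hl⟩ : ∃ l : K ⟶ E⟦(n : ℤ)⟧, k ≫ e.inv = l ≫ ((n : ℤ).negOnePow • f⟦(n : ℤ)⟧') :=
      Triangle.coyoneda_exact₂ _ hT' (k ≫ e.inv) hk'
    refine ⟨E, hE, l, ((n : ℤ).negOnePow • f⟦(n : ℤ)⟧') ≫ e.hom, ?_⟩
    rw [← Category.assoc, ← hl, Category.assoc, e.inv_hom_id, Category.comp_id]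
  choose next φ hφ using hstep
  let seq : ∀ n : ℕ, {D : C // t.le (-n) D} := fun n =>
    Nat.rec ⟨F, by simpa using hF⟩ (fun n D => next n D) n
  let X : ℕ ⥤ C := Functor.ofSequence (X := fun n => (seq n).1) fun n => φ n (seq n)
  refine ⟨X, Iso.refl _, fun n => (seq n).2, fun n K f hf => hφ n (seq n) K f ?_⟩
  have : X.map (homOfLE n.le_succ) = φ n (seq n) := Functor.ofSequence_map_homOfLE_succ _ n
  rw [← this]
  exact hf

/-- If `k` dies at stage `n + 1`, its image at stage `n` factors through a q-torsion object, so `q •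
k` dies at stage `n` already. -/
lemma nsmul_eq_zero_of_tower {X : ℕ ⥤ C} {P : ObjectProperty C} {q : ℕ}
    (hP : ∀ E, P E → q • 𝟙 E = 0)
    (hX : ∀ (n : ℕ) (K : C) (f : K ⟶ X.obj n), f ≫ X.map (homOfLE n.le_succ) = 0 →
        ∃ (E : C) (_ : P E) (g : K ⟶ E⟦(n : ℤ)⟧) (h : E⟦(n : ℤ)⟧ ⟶ X.obj n), f = g ≫ h)
    {K : C} (n : ℕ) (k : K ⟶ X.obj 0) (hk : k ≫ X.map (homOfLE (Nat.zero_le n)) = 0) :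
    (q ^ n) • k = 0 := by
  induction n generalizing k with
  | zero =>
    rw [show X.map (homOfLE (Nat.zero_le 0)) = 𝟙 _ from X.map_id 0, Category.comp_id] at hk
    rw [hk, smul_zero]
  | succ n ih =>
    rw [← homOfLE_comp (Nat.zero_le n) n.le_succ, X.map_comp, ← Category.assoc] at hk
    obtain ⟨E, hE, g, h, hgh⟩ := hX n K _ hk
    rw [pow_succ, mul_smul]
    refine ih (q • k) ?_
    rw [Preadditive.nsmul_comp, hgh, ← Preadditive.nsmul_comp,
      nsmul_eq_zero_of_nsmul_id' (nsmul_id_shift (hP E hE) n), zero_comp]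

lemma eq_zero_of_tower {X : ℕ ⥤ C} {P : ObjectProperty C} {K : C}
    (hP : ∀ E, P E → ∀ (n : ℕ) (f : K ⟶ E⟦(n : ℤ)⟧), f = 0)
    (hX : ∀ (n : ℕ) (K : C) (f : K ⟶ X.obj n), f ≫ X.map (homOfLE n.le_succ) = 0 →
        ∃ (E : C) (_ : P E) (g : K ⟶ E⟦(n : ℤ)⟧) (h : E⟦(n : ℤ)⟧ ⟶ X.obj n), f = g ≫ h)
    (n : ℕ) (k : K ⟶ X.obj 0) (hk : k ≫ X.map (homOfLE (Nat.zero_le n)) = 0) : k = 0 := by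
  induction n with
  | zero =>
    rwa [show X.map (homOfLE (Nat.zero_le 0)) = 𝟙 _ from X.map_id 0, Category.comp_id] at hk
  | succ n ih =>
    rw [← homOfLE_comp (Nat.zero_le n) n.le_succ, X.map_comp, ← Category.assoc] at hk
    obtain ⟨E, hE, g, h, hgh⟩ := hX n K _ hk
    exact ih (by rw [hgh, hP E hE n g, zero_comp])

/-- The aisle of a t-structure in which approximations exist is bounded above. -/
lemma exists_forall_hom_eq_zero [HasCoproducts.{u} C] {G H : C} (hG : IsCompactObj.{u} G)
    (hH : CompactlyGenerates.{u} (ObjectProperty.singleton H))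
    (t : Triangulated.TStructure C) {A : ℕ}
    (hA : ∀ F : C, t.le 0 F → ∀ f : H⟦(-A : ℤ)⟧ ⟶ F, f = 0)
    (happ : ∀ F : C, t.le 0 F → HasApproximation (generatedIn.{u} H A (-A) A) (t.le (-1)) F)
    {m : ℤ} (hm : ∀ i, m ≤ i → ∀ f : G ⟶ H⟦i⟧, f = 0) {F : C} (hF : t.le 0 F) {i : ℤ}
    (hi : m + A ≤ i) (f : G ⟶ F⟦i⟧) : f = 0 := by
  have : HasCoproductsOfShape ℕ C := (hasCoproducts_shrink.{0, u} (C := C)) ℕ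
  revert f
  rw [← hom_shift_eq_zero_iff (neg_add_cancel i)]
  obtain ⟨X, e, hXle, hX⟩ := exists_tower t happ hF
  refine hom_eq_zero_of_iso' e.symm fun k => ?_
  -- Stage `m` lies in `t.le (-m)`, so it receives no nonzero morphism from `H[j]` once m ≥ A + j.
  obtain ⟨n, hn⟩ := (hH.1 H (by simp)).exists_comp_map_eq_zero X hH.2 (fun j n a => by
    refine ⟨max n (A + j).toNat, le_max_left _ _, ?_⟩
    refine (?_ : ∀ a : H⟦j⟧ ⟶ X.obj (max n (A + j).toNat), a = 0) _
    have h1 := hA _ (t.le_monotone (show -((max n (A + j).toNat : ℕ) : ℤ) - (-A - j) ≤ 0 by lia) _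
      (t.le_shift _ (-A - j) _ (by lia) _ (hXle (max n (A + j).toNat))))
    rw [← hom_shift_eq_zero_iff (show (j + A) + (-A - j) = 0 by lia)] at h1
    exact hom_eq_zero_of_iso ((shiftFunctorAdd' C (-A : ℤ) (j + A) j (by lia)).app H) h1)
    (hG.shift (-i)) k
  -- The objects `E[n]` between consecutive stages receive nothing from `G[-i]`, so a morphism that
  -- dies at some stage is zero. The stage may depend on `F`; the bound on `i` does not.
  refine eq_zero_of_tower (fun E hE n f => ?_) hX n k hn
  exact hom_shift_shift_eq_zero rfl (fun f => hE.hom_eq_zero hG hm (by lia) f) f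

lemma TStructure.le_of_bigExtensionClosure [IsTriangulated C] (t : Triangulated.TStructure C)
    {n : ℤ} {P : ObjectProperty C} (hP : ∀ X, P X → t.le n X) {X : C}
    (hX : bigExtensionClosure.{u} P X) : t.le n X := by
  refine Triangulated.TStructure.IsLE.le (t := t) (self := ?_)
  rw [t.isLE_iff_orthogonal n (n + 1) rfl]
  intro Y f hY
  exact hX.hom_eq_zero (fun Z hZ g => t.zero_of_isLE_of_isGE g n (n + 1) (by lia) ⟨hP Z hZ⟩ hY) f

/-- A category compactly generated by a weakly negative `p`-torsion object `G` is not approximable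
if iterated self-extensions of `G` have unbounded `p`-torsion. -/
theorem not_isApproximable [IsTriangulated C] {G : C}
    (hG : CompactlyGenerates.{u} (ObjectProperty.singleton G))
    (hneg : IsWeaklyNegative (ObjectProperty.singleton G))
    (hsmall : ∀ (i : ℤ) (X : C), Small.{u} (G⟦i⟧ ⟶ X)) {p : ℕ} (hp : p • 𝟙 G = 0)
    (hF : ∀ N : ℕ, ∃ F : C, bigExtensionClosure.{u} (shifts (ObjectProperty.singleton G) {0}) F ∧
      (p ^ N) • 𝟙 F ≠ 0) : ¬ IsApproximable.{u} C := by
  rintro ⟨hC, H, t, A, hA, hH, hHle, hHzero, happ⟩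
  have hG' : IsCompactObj.{u} G := hG.1 G (by simp)
  have hH' : IsCompactObj.{u} H := hH.1 H (by simp)
  obtain ⟨k, hk⟩ := exists_pow_nsmul_id hG hp hH'
  obtain ⟨s, hs⟩ := hG'.exists_le hH t hHle
  obtain ⟨c, hc⟩ : ∃ c, aisle.{u} G c H :=
    hH'.exists_le hG (generatedTStructure hG' hsmall) (shift_mem_aisle G (i := 0) (by simp))
  have hm : ∀ i, c + 2 ≤ i → ∀ f : G ⟶ H⟦i⟧, f = 0 := by
    intro i hi
    rw [← hom_shift_eq_zero_iff (neg_add_cancel i)]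
    exact hom_aisle_eq_zero hG' (hneg G G (by simp) (by simp)) (by lia) hc
  have hbdd := fun F hF i hi => exists_forall_hom_eq_zero hG' hH t hHzero happ hm (F := F) hF
    (i := i) hi
  -- Chosen so that n - s ≥ c + 2 + A, which makes Hom(G, Y[n - s]) vanish for Y in `t.le 0`, in
  -- particular for Y = X_n[-n]. It is fixed before `F`.
  let n : ℕ := (c + 2 + A + s).toNat
  obtain ⟨F, hF, hFp⟩ := hF (k * A * n)
  have hFle : t.le s F := by
    refine TStructure.le_of_bigExtensionClosure t (fun X hX => ?_) hF
    obtain ⟨i, hi, ⟨e⟩⟩ := shifts_singleton_iff.1 hX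
    obtain rfl : i = 0 := hi
    exact (t.le s).prop_of_iso (e ≪≫ (shiftFunctorZero C ℤ).app G).symm hs
  obtain ⟨X, e, hXle, hX⟩ := exists_tower t happ (t.le_shift s s 0 (by simp) F hFle)
  have hzero : e.inv ≫ X.map (homOfLE (Nat.zero_le n)) = 0 := by
    refine (?_ : ∀ f : F⟦s⟧ ⟶ X.obj n, f = 0) _
    rw [hom_shift_eq_zero_iff (show s + -s = 0 by simp)]
    refine fun f => hF.hom_eq_zero (fun Y hY => ?_) f
    obtain ⟨i, hi, ⟨e⟩⟩ := shifts_singleton_iff.1 hY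
    obtain rfl : i = 0 := hi
    refine hom_eq_zero_of_iso (e ≪≫ (shiftFunctorZero C ℤ).app G) ?_
    refine hom_eq_zero_of_iso' ((shiftFunctorAdd' C (-n : ℤ) (n - s) (-s) (by lia)).app (X.obj n))
      (hbdd _ ?_ _ (by lia))
    exact t.le_shift _ _ _ (by simp) _ (hXle n)
  have h1 := nsmul_eq_zero_of_tower (fun E hE => hE.nsmul_id hk) hX n e.inv hzero
  rw [← pow_mul, ← pow_mul, ← mul_assoc] at h1
  refine hFp (nsmul_id_of_shift (n := s) ?_)
  rw [← e.inv_hom_id, ← Preadditive.nsmul_comp, h1, zero_comp]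

end NotApproximable

/-! ### Coproducts in Verdier quotients. -/

section Localization

variable {K : Type*} [Category* K] [Preadditive K] [HasZeroObject K] [HasShift K ℤ]
  [∀ n : ℤ, (shiftFunctor K n).Additive] [Pretriangulated K]
  {D : Type*} [Category* D] [Preadditive D]

/-- A coproduct of morphisms whose cones lie in a class that is closed under coproducts has its
cone in this class. -/
lemma trW_of_isColimit {ι : Type t} [HasCoproductsOfShape ι K] (P : ObjectProperty K)
    (hP : ∀ (F : ι → K) (c : Cofan F), IsColimit c → (∀ i, P (F i)) → P c.pt)
    {X Y : ι → K} (s : ∀ i, X i ⟶ Y i) (hs : ∀ i, P.trW (s i)) {c : Cofan X} (hc : IsColimit c)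
    {d : Cofan Y} (hd : IsColimit d) :
    P.trW (Cofan.IsColimit.desc hc fun i => s i ≫ d.inj i) := by
  choose Z g h hT hZ using hs
  obtain ⟨f, g', h', hT', hf⟩ := exists_distTriang_of_isColimit
    (fun i => Triangle.mk (s i) (g i) (h i)) hT hc hd (coproductIsCoproduct Z)
  have : Cofan.IsColimit.desc hc (fun i => s i ≫ d.inj i) = f :=
    Cofan.IsColimit.hom_ext hc _ _ fun i => by
      rw [Cofan.IsColimit.fac]
      exact (hf i).symm
  rw [this]
  exact ⟨_, g', h', hT', hP Z _ (coproductIsCoproduct Z) hZ⟩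

/-- Verdier quotients by subcategories closed under coproducts preserve coproducts. -/
theorem isColimit_map_of_isLocalization [IsTriangulated K] {ι : Type t} [HasCoproductsOfShape ι K]
    (P : ObjectProperty K) [P.IsTriangulated]
    (hP : ∀ (F : ι → K) (c : Cofan F), IsColimit c → (∀ i, P (F i)) → P c.pt)
    (L : K ⥤ D) [L.Additive] [L.IsLocalization P.trW]
    {X : ι → K} {c : Cofan X} (hc : IsColimit c) :
    Nonempty (IsColimit (Cofan.mk (L.obj c.pt) fun i => L.map (c.inj i))) := by
  have hL : L.EssSurj := Localization.essSurj L P.trW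
  -- Each `f i` is represented by a fraction with denominator `s i`; the coproduct of the
  -- denominators is again a denominator.
  have hexist : ∀ (Z : D) (f : ∀ i, L.obj (X i) ⟶ Z), ∃ g : L.obj c.pt ⟶ Z,
      ∀ i, L.map (c.inj i) ≫ g = f i := by
    intro Z f
    let e := L.objObjPreimageIso Z
    have H : ∀ i, ∃ (X' : K) (s : X' ⟶ X i) (_ : P.trW s) (g : X' ⟶ L.objPreimage Z),
        L.map s ≫ f i ≫ e.inv = L.map g := by
      intro i
      obtain ⟨φ, hφ⟩ := Localization.exists_rightFraction L P.trW (f i ≫ e.inv)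
      exact ⟨φ.X', φ.s, φ.hs, φ.f, by
        rw [hφ]
        exact φ.map_s_comp_map L (Localization.inverts L P.trW)⟩
    choose X' s hs g hg using H
    let hc' := coproductIsCoproduct X'
    have hS := trW_of_isColimit P hP s hs hc' hc
    let S := Cofan.IsColimit.desc hc' fun i => s i ≫ c.inj i
    have : IsIso (L.map S) := Localization.inverts L P.trW _ hS
    have hιS : ∀ i, Sigma.ι X' i ≫ S = s i ≫ c.inj i := fun i => Cofan.IsColimit.fac hc' _ i
    refine ⟨inv (L.map S) ≫ L.map (Sigma.desc g) ≫ e.hom, fun i => ?_⟩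
    have : IsIso (L.map (s i)) := Localization.inverts L P.trW _ (hs i)
    rw [← cancel_epi (L.map (s i)), ← Category.assoc, ← L.map_comp, ← hιS, L.map_comp,
      Category.assoc, IsIso.hom_inv_id_assoc, ← Category.assoc, ← L.map_comp, Sigma.ι_desc, ← hg,
      Category.assoc, Category.assoc, e.inv_hom_id, Category.comp_id]
  -- After clearing a denominator on the left, the components of the numerator are killed by
  -- denominators `s i` on the right, hence the numerator is killed by their coproduct.
  have hzero : ∀ (Z : D) (f : L.obj c.pt ⟶ Z), (∀ i, L.map (c.inj i) ≫ f = 0) → f = 0 := by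
    intro Z f hf
    let e := L.objObjPreimageIso Z
    obtain ⟨φ, hφ⟩ := Localization.exists_leftFraction L P.trW (f ≫ e.inv)
    have : IsIso (L.map φ.s) := Localization.inverts L P.trW _ φ.hs
    have hφ' : (f ≫ e.inv) ≫ L.map φ.s = L.map φ.f := by
      rw [hφ]
      exact φ.map_comp_map_s L (Localization.inverts L P.trW)
    have H : ∀ i, ∃ (X' : K) (s : X' ⟶ X i) (_ : P.trW s), s ≫ c.inj i ≫ φ.f = s ≫ 0 := by
      intro i
      rw [← MorphismProperty.map_eq_iff_precomp L P.trW, L.map_comp, ← hφ', ← Category.assoc,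
        ← Category.assoc, hf, zero_comp, zero_comp, L.map_zero]
    choose X' s hs hs' using H
    let hc' := coproductIsCoproduct X'
    have hS := trW_of_isColimit P hP s hs hc' hc
    let S := Cofan.IsColimit.desc hc' fun i => s i ≫ c.inj i
    have : IsIso (L.map S) := Localization.inverts L P.trW _ hS
    have hιS : ∀ i, Sigma.ι X' i ≫ S = s i ≫ c.inj i := fun i => Cofan.IsColimit.fac hc' _ i
    have h0 : S ≫ φ.f = 0 := Sigma.hom_ext _ _ fun i => by
      rw [← Category.assoc, hιS, Category.assoc, hs', comp_zero, comp_zero]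
    have h1 : L.map φ.f = 0 := by
      rw [← cancel_epi (L.map S), ← L.map_comp, h0, L.map_zero, comp_zero]
    rw [h1] at hφ'
    have h2 : f ≫ e.inv = 0 := by
      rw [← cancel_mono (L.map φ.s), hφ', zero_comp]
    rw [← cancel_mono e.inv, h2, zero_comp]
  choose desc hdesc using hexist
  refine ⟨Cofan.IsColimit.mk _ (fun t => desc t.pt t.inj) (fun t i => hdesc _ _ i) fun t m hm => ?_⟩
  rw [← sub_eq_zero]
  refine hzero _ _ fun i => ?_
  rw [Preadditive.comp_sub, hdesc, sub_eq_zero]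
  exact hm i

end Localization

/-! ### Elements of coproducts of abelian groups. -/

section Ab

lemma exists_eq_sum_of_isColimit {ι : Type t} {F : ι → AddCommGrpCat.{u}} {c : Cofan F}
    (hc : IsColimit c) (x : c.pt) : ∃ s : Finset ι, ∑ i ∈ s, c.inj i (cofanProj hc i x) = x := by
  classical
  let S : AddSubgroup c.pt := AddSubgroup.closure {y | ∃ (i : ι) (g : F i), y = c.inj i g}
  let q : c.pt ⟶ AddCommGrpCat.of (c.pt ⧸ S) := AddCommGrpCat.ofHom (QuotientAddGroup.mk' S)
  have hq : q = 0 := Cofan.IsColimit.hom_ext hc _ _ fun i => by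
    ext g
    exact (QuotientAddGroup.eq_zero_iff _).2 (AddSubgroup.subset_closure ⟨i, g, rfl⟩)
  have hx : x ∈ S := (QuotientAddGroup.eq_zero_iff _).1 (ConcreteCategory.congr_hom hq x)
  have H : ∀ x ∈ S, ∃ s : Finset ι, ∀ T, s ⊆ T →
      ∑ j ∈ T, c.inj j (cofanProj hc j x) = x := by
    intro x hx
    induction hx using AddSubgroup.closure_induction with
    | mem x hx =>
      obtain ⟨i, g, rfl⟩ := hx
      refine ⟨{i}, fun T hT => ?_⟩
      rw [Finset.sum_eq_single i]
      · exact congrArg _ (ConcreteCategory.congr_hom (inj_cofanProj_self hc i) g)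
      · intro j _ hij
        have : cofanProj hc j (c.inj i g) = 0 :=
          ConcreteCategory.congr_hom (inj_cofanProj_of_ne hc hij.symm) g
        rw [this, map_zero]
      · exact fun h => (h (hT (by simp))).elim
    | zero => exact ⟨∅, by simp⟩
    | add x y _ _ hx hy =>
      obtain ⟨s, hs⟩ := hx
      obtain ⟨s', hs'⟩ := hy
      refine ⟨s ∪ s', fun T hT => ?_⟩
      simp only [map_add, Finset.sum_add_distrib]
      rw [hs T (Finset.union_subset_left hT), hs' T (Finset.union_subset_right hT)]
    | neg x _ hx =>
      obtain ⟨s, hs⟩ := hx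
      refine ⟨s, fun T hT => ?_⟩
      simp only [map_neg, Finset.sum_neg_distrib]
      rw [hs T hT]
  obtain ⟨s, hs⟩ := H x hx
  exact ⟨s, hs s subset_rfl⟩

end Ab

/-! ### Coproducts in the homotopy category. -/

section HomotopyCategory

open HomologicalComplex

variable {A : Type*} [Category* A] [Preadditive A]

/-- Coproducts of complexes are computed degreewise. -/
def isColimitCofanEval {ι : Type t} [HasCoproductsOfShape ι A]
    {X : ι → CochainComplex A ℤ} {c : Cofan X} (hc : IsColimit c) (n : ℤ) :
    IsColimit (Cofan.mk (c.pt.X n) fun i => (c.inj i).f n) :=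
  isColimitCofanMkObjOfIsColimit (eval A (ComplexShape.up ℤ) n) _ _ hc

/-- Homotopies on the summands of a coproduct of complexes can be assembled. -/
lemma homotopy_zero_of_isColimit {ι : Type t} [HasCoproductsOfShape ι A]
    {X : ι → CochainComplex A ℤ} {c : Cofan X} (hc : IsColimit c) {Y : CochainComplex A ℤ}
    (f : c.pt ⟶ Y) (h : ∀ i, Nonempty (Homotopy (c.inj i ≫ f) 0)) : Nonempty (Homotopy f 0) := by
  let hn := isColimitCofanEval hc
  have h' := fun i => (h i).some
  let σ : ∀ i j, c.pt.X i ⟶ Y.X j := fun i j => Cofan.IsColimit.desc (hn i) fun k => (h' k).hom i j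
  have hσ : ∀ k i j, (c.inj k).f i ≫ σ i j = (h' k).hom i j := fun k i j =>
    Cofan.IsColimit.fac (hn i) _ k
  refine ⟨{ hom := σ, zero := fun i j hij => ?_, comm := fun i => ?_ }⟩
  · refine Cofan.IsColimit.hom_ext (hn i) _ _ fun k => ?_
    rw [comp_zero]
    exact (hσ k i j).trans ((h' k).zero i j hij)
  · refine Cofan.IsColimit.hom_ext (hn i) _ _ fun k => ?_
    have h1 := (h' k).comm i
    rw [dNext_eq _ (show (ComplexShape.up ℤ).Rel i (i + 1) from rfl),
      prevD_eq _ (show (ComplexShape.up ℤ).Rel (i - 1) i by simp)] at h1 ⊢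
    change (c.inj k).f i ≫ f.f i = (c.inj k).f i ≫ _
    rw [← comp_f, h1, Preadditive.comp_add, Preadditive.comp_add, ← Category.assoc,
      ← Category.assoc, hσ, (c.inj k).comm, Category.assoc, hσ]
    simp

/-- The quotient functor to the homotopy category preserves coproducts. -/
theorem isColimit_quotient {ι : Type t} [HasCoproductsOfShape ι A]
    {X : ι → CochainComplex A ℤ} {c : Cofan X} (hc : IsColimit c) :
    Nonempty (IsColimit (Cofan.mk ((HomotopyCategory.quotient A (.up ℤ)).obj c.pt)
      fun i => (HomotopyCategory.quotient A (.up ℤ)).map (c.inj i))) := by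
  let q := HomotopyCategory.quotient A (.up ℤ)
  have hexist : ∀ (Z : HomotopyCategory A (.up ℤ)) (f : ∀ i, q.obj (X i) ⟶ Z),
      ∃ g : q.obj c.pt ⟶ Z, ∀ i, q.map (c.inj i) ≫ g = f i := by
    intro Z f
    obtain ⟨Z, rfl⟩ := HomotopyCategory.quotient_obj_surjective Z
    choose f' hf' using fun i => q.map_surjective (f i)
    refine ⟨q.map (Cofan.IsColimit.desc hc f'), fun i => ?_⟩
    rw [← q.map_comp, Cofan.IsColimit.fac, hf']
  have hzero : ∀ (Z : HomotopyCategory A (.up ℤ)) (f : q.obj c.pt ⟶ Z),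
      (∀ i, q.map (c.inj i) ≫ f = 0) → f = 0 := by
    intro Z f hf
    obtain ⟨Z, rfl⟩ := HomotopyCategory.quotient_obj_surjective Z
    obtain ⟨f, rfl⟩ := q.map_surjective f
    refine (HomotopyCategory.quotient_map_eq_zero_iff f).2
      (homotopy_zero_of_isColimit hc f fun i => ?_)
    rw [← HomotopyCategory.quotient_map_eq_zero_iff]
    exact (q.map_comp _ _).trans (hf i)
  choose desc hdesc using hexist
  refine ⟨Cofan.IsColimit.mk _ (fun t => desc t.pt t.inj) (fun t i => hdesc _ _ i) fun t m hm => ?_⟩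
  rw [← sub_eq_zero]
  refine hzero _ _ fun i => ?_
  rw [Preadditive.comp_sub, hdesc, sub_eq_zero]
  exact hm i

instance {ι : Type t} [HasCoproductsOfShape ι A] :
    HasCoproductsOfShape ι (HomotopyCategory A (.up ℤ)) := by
  have : ∀ F : ι → HomotopyCategory A (.up ℤ), HasCoproduct F := by
    intro F
    choose X hX using fun i => HomotopyCategory.quotient_obj_surjective (F i)
    obtain rfl : (fun i => (HomotopyCategory.quotient A (.up ℤ)).obj (X i)) = F := funext hX
    exact ⟨_, (isColimit_quotient (coproductIsCoproduct X)).some⟩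
  exact ⟨fun F => have := this fun i => F.obj ⟨i⟩; hasColimit_of_iso Discrete.natIsoFunctor⟩

end HomotopyCategory

/-! ### Coproducts in D(Ab). -/

section AbComplexes

open HomologicalComplex

variable {ι : Type u} {X : ι → CochainComplex AddCommGrpCat.{u} ℤ} {c : Cofan X}

lemma exists_sum_cofanProj_f (hc : IsColimit c) (n : ℤ) (x : c.pt.X n) :
    ∃ s : Finset ι, ∑ i ∈ s, (c.inj i).f n ((cofanProj hc i).f n x) = x := by
  obtain ⟨s, hs⟩ := exists_eq_sum_of_isColimit (isColimitCofanEval hc n) x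
  refine ⟨s, Eq.trans (Finset.sum_congr rfl fun i _ => ?_) hs⟩
  have : (cofanProj hc i).f n = cofanProj (isColimitCofanEval hc n) i :=
    Cofan.IsColimit.hom_ext (isColimitCofanEval hc n) _ _ fun j => by
      by_cases h : j = i
      · subst h
        exact (congr_hom (inj_cofanProj_self hc j) n).trans
          (inj_cofanProj_self (isColimitCofanEval hc n) j).symm
      · exact (congr_hom (inj_cofanProj_of_ne hc h) n).trans
          (inj_cofanProj_of_ne (isColimitCofanEval hc n) h).symm
  rw [this]
  rfl

/-- A coproduct of exact complexes of abelian groups is exact. -/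
lemma exactAt_of_isColimit (hc : IsColimit c) {n : ℤ} (h : ∀ i, (X i).ExactAt n) :
    c.pt.ExactAt n := by
  have h0 := fun K : CochainComplex AddCommGrpCat.{u} ℤ =>
    (K.exactAt_iff' (n - 1) n (n + 1) (by simp) (by simp)).trans (ShortComplex.ab_exact_iff _)
  simp only [h0] at h ⊢
  intro (x : c.pt.X n) (hx : c.pt.d n (n + 1) x = 0)
  obtain ⟨s, hs⟩ := exists_sum_cofanProj_f hc n x
  have hy : ∀ j, ∃ y : (X j).X (n - 1), (X j).d (n - 1) n y = (cofanProj hc j).f n x := by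
    intro j
    refine h j _ ?_
    have h1 : (X j).d n (n + 1) ((cofanProj hc j).f n x) =
        (cofanProj hc j).f (n + 1) (c.pt.d n (n + 1) x) :=
      ConcreteCategory.congr_hom ((cofanProj hc j).comm n (n + 1)) x
    exact h1.trans ((congrArg _ hx).trans (map_zero _))
  choose y hy using hy
  refine ⟨(∑ i ∈ s, (c.inj i).f (n - 1) (y i) : c.pt.X (n - 1)), ?_⟩
  change c.pt.d (n - 1) n (∑ i ∈ s, (c.inj i).f (n - 1) (y i)) = x
  rw [← hs, map_sum]
  refine Finset.sum_congr rfl fun i _ => ?_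
  rw [← hy i]
  exact ConcreteCategory.congr_hom ((c.inj i).comm (n - 1) n) (y i)

lemma subcategoryAcyclic_of_isColimit
    (F : ι → HomotopyCategory AddCommGrpCat.{u} (.up ℤ)) (c : Cofan F) (hc : IsColimit c)
    (h : ∀ i, HomotopyCategory.subcategoryAcyclic _ (F i)) :
    HomotopyCategory.subcategoryAcyclic _ c.pt := by
  choose X hX using fun i => HomotopyCategory.quotient_obj_surjective (F i)
  obtain rfl : (fun i => (HomotopyCategory.quotient _ (.up ℤ)).obj (X i)) = F := funext hX
  have hX' := isColimit_quotient (coproductIsCoproduct X)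
  refine ObjectProperty.prop_of_iso _ (hX'.some.coconePointUniqueUpToIso hc) ?_
  change HomotopyCategory.subcategoryAcyclic _ ((HomotopyCategory.quotient _ _).obj (∐ X))
  rw [HomotopyCategory.quotient_obj_mem_subcategoryAcyclic_iff_exactAt]
  refine fun n => exactAt_of_isColimit (coproductIsCoproduct X) fun i => ?_
  exact (HomotopyCategory.quotient_obj_mem_subcategoryAcyclic_iff_exactAt _).1 (h i) n

variable [HasDerivedCategory.{w} AddCommGrpCat.{u}]

/-- Coproducts in `D(Ab)` are computed on the level of complexes. -/
theorem isColimit_derived (hc : IsColimit c) :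
    Nonempty (IsColimit (Cofan.mk
      (DerivedCategory.Qh.obj ((HomotopyCategory.quotient _ _).obj c.pt))
      fun i => DerivedCategory.Qh.map ((HomotopyCategory.quotient _ _).map (c.inj i)))) :=
  isColimit_map_of_isLocalization (HomotopyCategory.subcategoryAcyclic _)
    subcategoryAcyclic_of_isColimit DerivedCategory.Qh (isColimit_quotient hc).some

lemma exists_iso_derived (X : DerivedCategory AddCommGrpCat.{u}) :
    ∃ K : CochainComplex AddCommGrpCat.{u} ℤ, Nonempty
      (DerivedCategory.Qh.obj ((HomotopyCategory.quotient _ _).obj K) ≅ X) := by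
  obtain ⟨K, hK⟩ := HomotopyCategory.quotient_obj_surjective
    (DerivedCategory.Qh.objPreimage X)
  exact ⟨K, ⟨DerivedCategory.Qh.mapIso (eqToIso hK) ≪≫ DerivedCategory.Qh.objObjPreimageIso X⟩⟩

instance : HasCoproducts.{u} (DerivedCategory AddCommGrpCat.{u}) := by
  intro ι
  refine ⟨fun F => ?_⟩
  choose K hK using fun i => exists_iso_derived (F.obj ⟨i⟩)
  let A : ι → DerivedCategory AddCommGrpCat.{u} := fun i =>
    DerivedCategory.Qh.obj ((HomotopyCategory.quotient AddCommGrpCat.{u} (.up ℤ)).obj (K i))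
  have : HasColimit (Discrete.functor A) :=
    ⟨_, (isColimit_derived (coproductIsCoproduct K)).some⟩
  exact hasColimit_of_iso (G := F) (F := Discrete.functor A)
    (Discrete.natIso fun i => (hK i.as).some.symm)

end AbComplexes

/-! ### The object ℤ of D(Ab): compactness and morphisms out of it. -/

section Integers

/-- The group `ℤ`, in an arbitrary universe. -/
abbrev intGrp : AddCommGrpCat.{u} := AddCommGrpCat.of (ULift.{u} ℤ)

lemma intGrp_hom_ext {A : AddCommGrpCat.{u}} {f g : intGrp.{u} ⟶ A}
    (h : f (ULift.up 1) = g (ULift.up 1)) : f = g := by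
  have h' : f.hom.comp (AddEquiv.ulift (α := ℤ)).symm.toAddMonoidHom =
      g.hom.comp (AddEquiv.ulift (α := ℤ)).symm.toAddMonoidHom := AddMonoidHom.ext_int h
  ext x
  exact DFunLike.congr_fun h' x.down

/-- The morphism from `ℤ` that corresponds to an element. -/
def intGrpHom {A : AddCommGrpCat.{u}} (a : A) : intGrp.{u} ⟶ A :=
  AddCommGrpCat.ofHom ((zmultiplesHom A a).comp (AddEquiv.ulift (α := ℤ)).toAddMonoidHom)

lemma intGrpHom_apply {A : AddCommGrpCat.{u}} (a : A) : intGrpHom a (ULift.up 1) = a :=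
  one_zsmul a

instance : Projective intGrp.{u} where
  factors {E X} f e _ := by
    obtain ⟨a, ha⟩ := (AddCommGrpCat.epi_iff_surjective e).1 inferInstance (f (ULift.up 1))
    refine ⟨intGrpHom a, intGrp_hom_ext ?_⟩
    exact (congrArg e (intGrpHom_apply a)).trans ha

open HomologicalComplex

/-- The complex `ℤ`, in degree `0`. -/
abbrev intComplex : CochainComplex AddCommGrpCat.{u} ℤ :=
  (single AddCommGrpCat.{u} (.up ℤ) 0).obj intGrp.{u}

/-- A bounded above complex of projectives. Morphisms from ℤ in D(Ab) are therefore represented by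
chain maps, that is, by elements in degree 0. -/
instance : intComplex.{u}.IsKProjective := by
  have : ∀ n : ℤ, Projective (intComplex.{u}.X n) := by
    intro n
    by_cases h : n = 0
    · subst h
      exact Projective.of_iso (singleObjXSelf (.up ℤ) 0 intGrp.{u}).symm inferInstance
    · exact (isZero_single_obj_X (.up ℤ) 0 intGrp.{u} n h).projective
  have : intComplex.{u}.IsStrictlyLE 0 := by
    rw [CochainComplex.isStrictlyLE_iff]
    exact fun i hi => isZero_single_obj_X _ _ _ _ hi.ne'
  exact CochainComplex.isKProjective_of_projective _ 0

lemma intComplex_hom_ext {K : CochainComplex AddCommGrpCat.{u} ℤ} {f g : intComplex ⟶ K}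
    (h : f.f 0 ((singleObjXSelf (.up ℤ) 0 intGrp.{u}).inv (ULift.up 1)) =
      g.f 0 ((singleObjXSelf (.up ℤ) 0 intGrp.{u}).inv (ULift.up 1))) : f = g := by
  apply from_single_hom_ext
  rw [← cancel_epi (singleObjXSelf (.up ℤ) 0 intGrp.{u}).inv]
  exact intGrp_hom_ext h

lemma exists_sum_intComplex {ι : Type u} {X : ι → CochainComplex AddCommGrpCat.{u} ℤ} {c : Cofan X}
    (hc : IsColimit c) (f : intComplex ⟶ c.pt) :
    ∃ s : Finset ι, ∑ i ∈ s, f ≫ cofanProj hc i ≫ c.inj i = f := by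
  obtain ⟨s, hs⟩ := exists_sum_cofanProj_f hc 0
    (f.f 0 ((singleObjXSelf (.up ℤ) 0 intGrp.{u}).inv (ULift.up 1)))
  refine ⟨s, intComplex_hom_ext (Eq.trans ?_ hs)⟩
  let E : (intComplex ⟶ c.pt) →+ c.pt.X 0 :=
    { toFun := fun f => f.f 0 ((singleObjXSelf (.up ℤ) 0 intGrp.{u}).inv (ULift.up 1))
      map_zero' := rfl
      map_add' := fun _ _ => rfl }
  change E _ = _
  rw [map_sum]
  rfl

variable [HasDerivedCategory.{w} AddCommGrpCat.{u}]

/-- The object `ℤ` of `D(Ab)`. -/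
abbrev intObj : DerivedCategory AddCommGrpCat.{u} :=
  (DerivedCategory.singleFunctor AddCommGrpCat.{u} 0).obj intGrp.{u}

lemma exists_map_eq {K : CochainComplex AddCommGrpCat.{u} ℤ}
    (f : intObj.{u, w} ⟶ DerivedCategory.Qh.obj ((HomotopyCategory.quotient _ _).obj K)) :
    ∃ φ : intComplex ⟶ K,
      DerivedCategory.Qh.map ((HomotopyCategory.quotient _ _).map φ) = f := by
  obtain ⟨g, hg⟩ := (CochainComplex.IsKProjective.Qh_map_bijective intComplex.{u}
    ((HomotopyCategory.quotient _ _).obj K)).surjective f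
  obtain ⟨φ, rfl⟩ := (HomotopyCategory.quotient _ _).map_surjective g
  exact ⟨φ, hg⟩

/-- Once the coproduct is replaced by a coproduct of complexes, `f` is a chain map given by a single
element, which has finitely many nonzero components. -/
lemma isCompactObj_intObj : IsCompactObj.{u} intObj.{u, w} := by
  refine isCompactObj_of_exists_sum fun {ι} F c hc f => ?_
  choose K hK using fun i => exists_iso_derived (F i)
  let q := HomotopyCategory.quotient AddCommGrpCat.{u} (.up ℤ)
  let L : CochainComplex AddCommGrpCat.{u} ℤ ⥤ DerivedCategory AddCommGrpCat.{u} :=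
    q ⋙ DerivedCategory.Qh
  let c' := coproductIsCoproduct K
  have hc' : IsColimit (Cofan.mk (L.obj (∐ K)) fun i => L.map (Sigma.ι K i)) :=
    (isColimit_derived c').some
  let e := fun i => (hK i).some
  let α : c.pt ⟶ L.obj (∐ K) := Cofan.IsColimit.desc hc fun i => (e i).inv ≫ L.map (Sigma.ι K i)
  let β : L.obj (∐ K) ⟶ c.pt := Cofan.IsColimit.desc hc' fun i => (e i).hom ≫ c.inj i
  have hα : ∀ i, c.inj i ≫ α = (e i).inv ≫ L.map (Sigma.ι K i) := fun i =>
    Cofan.IsColimit.fac hc _ i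
  have hβ : ∀ i, L.map (Sigma.ι K i) ≫ β = (e i).hom ≫ c.inj i := fun i =>
    Cofan.IsColimit.fac hc' _ i
  have hαβ : α ≫ β = 𝟙 _ := Cofan.IsColimit.hom_ext hc _ _ fun i => by
    rw [← Category.assoc, hα, Category.assoc, hβ, Iso.inv_hom_id_assoc, Category.comp_id]
  obtain ⟨φ, hφ⟩ : ∃ φ : intComplex ⟶ ∐ K, L.map φ = f ≫ α := exists_map_eq (f ≫ α)
  obtain ⟨s, hs⟩ := exists_sum_intComplex c' φ
  refine ⟨s, fun i => L.map (φ ≫ cofanProj c' i) ≫ (e i).hom, ?_⟩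
  have h1 : L.map φ = ∑ i ∈ s, L.map (φ ≫ cofanProj c' i) ≫ L.map (Sigma.ι K i) := by
    conv_lhs => rw [← hs]
    rw [L.map_sum]
    exact Finset.sum_congr rfl fun i _ => by rw [← Category.assoc, L.map_comp]; rfl
  have h2 : L.map φ ≫ β = ∑ i ∈ s, (L.map (φ ≫ cofanProj c' i) ≫ (e i).hom) ≫ c.inj i := by
    rw [h1, Preadditive.sum_comp]
    exact Finset.sum_congr rfl fun i _ => by rw [Category.assoc, hβ, Category.assoc]
  have h3 : f = (f ≫ α) ≫ β := by rw [Category.assoc, hαβ, Category.comp_id]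
  exact h3.trans (Eq.trans (congrArg (· ≫ β) hφ.symm) h2)

/-- Morphisms of D(Ab) live in the universe `w`, whereas `exists_cover` needs u-small index sets;
chain maps from ℤ form a u-small set. -/
lemma small_intObj_hom (X : DerivedCategory AddCommGrpCat.{u}) :
    Small.{u} (intObj.{u, w} ⟶ X) := by
  obtain ⟨K, ⟨e⟩⟩ := exists_iso_derived X
  refine small_of_surjective (α := (intComplex ⟶ K)) (f := fun φ =>
    (DerivedCategory.Qh.map ((HomotopyCategory.quotient _ _).map φ) ≫ e.hom : intObj ⟶ X)) ?_
  intro f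
  obtain ⟨φ, hφ⟩ := exists_map_eq (f ≫ e.inv)
  refine ⟨φ, Eq.trans (congrArg (· ≫ e.hom) hφ) ?_⟩
  change (f ≫ e.inv) ≫ e.hom = f
  rw [Category.assoc, e.inv_hom_id, Category.comp_id]

lemma intObj_hom_eq_zero {i : ℤ} (hi : i ≠ 0) (M : AddCommGrpCat.{u})
    (f : intObj.{u, w} ⟶
      ((DerivedCategory.singleFunctor AddCommGrpCat.{u} 0).obj M)⟦i⟧) : f = 0 := by
  let e := ((DerivedCategory.singleFunctors AddCommGrpCat.{u}).shiftIso i (-i) 0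
    (by simp)).app M
  rw [← cancel_mono e.hom, zero_comp]
  obtain ⟨φ, hφ⟩ := exists_map_eq
    (K := (single AddCommGrpCat.{u} (.up ℤ) (-i)).obj M) (f ≫ e.hom)
  have : φ = 0 := from_single_hom_ext
    ((isZero_single_obj_X (.up ℤ) (-i) M 0 (by omega)).eq_of_tgt _ _)
  refine hφ.symm.trans ((congrArg _ (congrArg _ this)).trans ?_)
  exact (congrArg _ (Functor.map_zero _ _ _)).trans (Functor.map_zero _ _ _)

end Integers

/-! ### Exact sequences of cyclic groups. -/

section Cyclic

/-- A homomorphism of abelian groups, in an arbitrary universe. -/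
def uliftHom {A B : Type} [AddCommGroup A] [AddCommGroup B] (f : A →+ B) :
    AddCommGrpCat.of (ULift.{u} A) ⟶ AddCommGrpCat.of (ULift.{u} B) :=
  AddCommGrpCat.ofHom ((AddEquiv.ulift.symm.toAddMonoidHom.comp f).comp
    AddEquiv.ulift.toAddMonoidHom)

/-- Short exact sequences of abelian groups, in an arbitrary universe. -/
lemma exists_distTriang_of_exact [HasDerivedCategory.{w} AddCommGrpCat.{u}]
    {A B D : Type} [AddCommGroup A] [AddCommGroup B] [AddCommGroup D]
    (f : A →+ B) (g : B →+ D) (hf : Function.Injective f) (hg : Function.Surjective g)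
    (hfg : Function.Exact f g) :
    ∃ δ, Triangle.mk ((DerivedCategory.singleFunctor AddCommGrpCat.{u} 0).map (uliftHom.{u} f))
      ((DerivedCategory.singleFunctor AddCommGrpCat.{u} 0).map (uliftHom.{u} g)) δ ∈
        distTriang (DerivedCategory AddCommGrpCat.{u}) := by
  let S : ShortComplex AddCommGrpCat.{u} := ShortComplex.mk (uliftHom.{u} f) (uliftHom.{u} g) <| by
    ext ⟨x⟩
    exact hfg.apply_apply_eq_zero x
  have hS : S.ShortExact :=
    { exact := (ShortComplex.ab_exact_iff _).2 fun ⟨x⟩ hx => by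
        obtain ⟨y, hy⟩ := (hfg x).1 (congrArg ULift.down hx)
        exact ⟨ULift.up y, congrArg ULift.up hy⟩
      mono_f := (AddCommGrpCat.mono_iff_injective _).2 fun ⟨x⟩ ⟨y⟩ h =>
        congrArg ULift.up (hf (congrArg ULift.down h))
      epi_g := (AddCommGrpCat.epi_iff_surjective _).2 fun ⟨x⟩ => by
        obtain ⟨y, hy⟩ := hg x
        exact ⟨ULift.up y, congrArg ULift.up hy⟩ }
  exact ⟨_, hS.singleTriangle_distinguished⟩

lemma exact_mulLeft_castAddHom {n : ℕ} :
    Function.Exact (AddMonoidHom.mulLeft (n : ℤ)) (Int.castAddHom (ZMod n)) := by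
  intro x
  rw [Int.coe_castAddHom, ZMod.intCast_zmod_eq_zero_iff_dvd]
  exact ⟨fun ⟨y, hy⟩ => ⟨y, hy.symm⟩, fun ⟨y, hy⟩ => ⟨y, hy.symm⟩⟩

/-- The homomorphism `ℤ/m ⟶ ℤ/nm` that is given by the multiplication by `n`. -/
def cyclicMul (m n : ℕ) : ZMod m →+ ZMod (n * m) :=
  ZMod.lift m ⟨(AddMonoidHom.mulLeft (n : ZMod (n * m))).comp (Int.castAddHom _), by
    change (n : ZMod (n * m)) * ((m : ℤ) : ZMod (n * m)) = 0
    rw [Int.cast_natCast, ← Nat.cast_mul, ZMod.natCast_self]⟩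

lemma cyclicMul_intCast (m n : ℕ) (x : ℤ) : cyclicMul m n (x : ZMod m) = (n : ZMod (n * m)) * x :=
  ZMod.lift_coe _ _ _

lemma cyclicMul_injective (m : ℕ) {n : ℕ} (hn : n ≠ 0) : Function.Injective (cyclicMul m n) := by
  rw [injective_iff_map_eq_zero]
  intro x hx
  obtain ⟨x, rfl⟩ := ZMod.intCast_surjective x
  rw [cyclicMul_intCast] at hx
  rw [ZMod.intCast_zmod_eq_zero_iff_dvd]
  have : ((n * x : ℤ) : ZMod (n * m)) = 0 := by exact_mod_cast hx
  rw [ZMod.intCast_zmod_eq_zero_iff_dvd] at this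
  push_cast at this
  exact (mul_dvd_mul_iff_left (by exact_mod_cast hn)).1 this

lemma exact_cyclicMul_castHom (m n : ℕ) :
    Function.Exact (cyclicMul m n) (ZMod.castHom (dvd_mul_right n m) (ZMod n)).toAddMonoidHom := by
  intro x
  obtain ⟨x, rfl⟩ := ZMod.intCast_surjective x
  change ZMod.castHom (dvd_mul_right n m) (ZMod n) (x : ZMod (n * m)) = 0 ↔ _
  rw [map_intCast, ZMod.intCast_zmod_eq_zero_iff_dvd]
  constructor
  · rintro ⟨y, rfl⟩
    exact ⟨(y : ZMod m), by rw [cyclicMul_intCast]; push_cast; rfl⟩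
  · rintro ⟨y, hy⟩
    obtain ⟨y, rfl⟩ := ZMod.intCast_surjective y
    rw [cyclicMul_intCast] at hy
    have h : ((n * y : ℤ) : ZMod (n * m)) = (x : ZMod (n * m)) := by exact_mod_cast hy
    rw [ZMod.intCast_eq_intCast_iff_dvd_sub] at h
    have h' : (n : ℤ) ∣ x - n * y := (Dvd.intro _ (by push_cast; rfl)).trans h
    simpa using h'.add (Dvd.intro y rfl)

end Cyclic

/-! ### Compactness and smallness of cones. -/

section Cones

variable {C : Type w'} [Category.{v'} C] [Preadditive C] [HasShift C ℤ]
  [∀ n : ℤ, (shiftFunctor C n).Additive]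

lemma small_hom_shift {X : C} (h : ∀ Y : C, Small.{u} (X ⟶ Y)) (n : ℤ) (Y : C) :
    Small.{u} (X⟦n⟧ ⟶ Y) :=
  have := h (Y⟦-n⟧)
  small_map (shiftHomEquiv (add_neg_cancel n) X Y).toEquiv

variable [HasZeroObject C] [Pretriangulated C]

/-- The cone of a morphism between compact objects is compact. -/
lemma IsCompactObj.of_distTriang {T : Triangle C} (hT : T ∈ distTriang C)
    (h₁ : IsCompactObj.{u} T.obj₁) (h₂ : IsCompactObj.{u} T.obj₂) : IsCompactObj.{u} T.obj₃ := by
  classical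
  refine isCompactObj_of_exists_sum fun {ι} F c hc f => ?_
  obtain ⟨s, hs⟩ := h₂.exists_finset hc (T.mor₂ ≫ f)
  -- Without its components in `s`, `f` vanishes on `T.obj₂`, so it comes from the compact object
  -- `T.obj₁[1]`.
  obtain ⟨h, hh⟩ : ∃ h : T.obj₁⟦(1 : ℤ)⟧ ⟶ c.pt,
      f - ∑ j ∈ s, f ≫ cofanProj hc j ≫ c.inj j = T.mor₃ ≫ h := by
    refine Triangle.yoneda_exact₃ T hT _ ?_
    rw [Preadditive.comp_sub, Preadditive.comp_sum, sub_eq_zero]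
    simpa only [Category.assoc] using (hs s subset_rfl).symm
  obtain ⟨s', g, rfl⟩ := (h₁.shift 1).exists_sum hc h
  refine ⟨s ∪ s', fun i => (if i ∈ s then f ≫ cofanProj hc i else 0) +
    if i ∈ s' then T.mor₃ ≫ g i else 0, ?_⟩
  rw [sub_eq_iff_eq_add', Preadditive.comp_sum] at hh
  conv_lhs => rw [hh]
  simp only [Preadditive.add_comp, Finset.sum_add_distrib, ite_comp, zero_comp,
    Finset.sum_ite_mem, Category.assoc]
  rw [Finset.inter_eq_right.2 Finset.subset_union_left,
    Finset.inter_eq_right.2 Finset.subset_union_right]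

/-- A morphism from `T.obj₃` is a chosen extension of its restriction to `T.obj₂` plus a correction
from `T.obj₁[1]`. -/
lemma small_hom_of_distTriang {T : Triangle C} (hT : T ∈ distTriang C)
    (h₁ : ∀ Y : C, Small.{u} (T.obj₁ ⟶ Y)) (h₂ : ∀ Y : C, Small.{u} (T.obj₂ ⟶ Y)) (Y : C) :
    Small.{u} (T.obj₃ ⟶ Y) := by
  classical
  have := h₂ Y
  have := small_hom_shift h₁ 1 Y
  let φ : (T.obj₂ ⟶ Y) × (T.obj₁⟦(1 : ℤ)⟧ ⟶ Y) → (T.obj₃ ⟶ Y) := fun x =>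
    (if h : ∃ f : T.obj₃ ⟶ Y, T.mor₂ ≫ f = x.1 then h.choose else 0) + T.mor₃ ≫ x.2
  refine small_of_surjective (f := φ) fun f => ?_
  have h : ∃ f' : T.obj₃ ⟶ Y, T.mor₂ ≫ f' = T.mor₂ ≫ f := ⟨f, rfl⟩
  obtain ⟨g, hg⟩ : ∃ g : T.obj₁⟦(1 : ℤ)⟧ ⟶ Y, f - h.choose = T.mor₃ ≫ g := by
    refine Triangle.yoneda_exact₃ T hT _ ?_
    rw [Preadditive.comp_sub, h.choose_spec, sub_self]
  refine ⟨(T.mor₂ ≫ f, g), ?_⟩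
  simp only [φ]
  rw [dif_pos h, ← hg]
  abel

end Cones

/-! ### The objects ℤ/n of D(Ab). -/

section CyclicObjects

variable [HasDerivedCategory.{w} AddCommGrpCat.{u}]

/-- The canonical morphism `ℤ ⟶ ℤ/n`. -/
def intToCyclic (n : ℕ) : intObj.{u, w} ⟶ cyclicObj.{u, w} n :=
  (DerivedCategory.singleFunctor AddCommGrpCat.{u} 0).map
    (uliftHom.{u} (Int.castAddHom (ZMod n)))

lemma dvd_of_nsmul_intToCyclic {n q : ℕ} (h : q • intToCyclic.{u, w} n = 0) : n ∣ q := by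
  rw [intToCyclic, ← Functor.map_nsmul] at h
  have h' : q • uliftHom.{u} (Int.castAddHom (ZMod n)) = 0 :=
    (DerivedCategory.singleFunctor AddCommGrpCat.{u} 0).map_injective
      (h.trans (Functor.map_zero _ _ _).symm)
  have h1 : q • (ULift.up ((1 : ℤ) : ZMod n) : ULift.{u} (ZMod n)) = 0 :=
    ConcreteCategory.congr_hom h' (ULift.up 1)
  have h2 : q • ((1 : ℤ) : ZMod n) = 0 := congrArg ULift.down h1
  rw [← ZMod.natCast_eq_zero_iff]
  simpa using h2

lemma nsmul_id_cyclicObj (n : ℕ) : n • 𝟙 (cyclicObj.{u, w} n) = 0 := by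
  have h : n • 𝟙 (AddCommGrpCat.of (ULift.{u} (ZMod n))) = 0 := by
    ext ⟨x⟩
    change n • x = 0
    simp
  rw [← CategoryTheory.Functor.map_id, ← Functor.map_nsmul]
  exact (congrArg _ h).trans (Functor.map_zero _ _ _)

lemma exists_int_distTriang {n : ℕ} (hn : n ≠ 0) :
    ∃ (f : intObj.{u, w} ⟶ intObj) (g : intObj ⟶ cyclicObj n) (h : cyclicObj n ⟶ intObj⟦(1 : ℤ)⟧),
      Triangle.mk f g h ∈ distTriang _ := by
  obtain ⟨δ, hδ⟩ := exists_distTriang_of_exact.{u, w} (AddMonoidHom.mulLeft (n : ℤ))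
    (Int.castAddHom (ZMod n)) (mul_right_injective₀ (by exact_mod_cast hn))
    ZMod.intCast_surjective exact_mulLeft_castAddHom
  exact ⟨_, _, δ, hδ⟩

lemma isCompactObj_cyclicObj {n : ℕ} (hn : n ≠ 0) : IsCompactObj.{u} (cyclicObj.{u, w} n) := by
  obtain ⟨f, g, h, hT⟩ := exists_int_distTriang.{u, w} hn
  exact IsCompactObj.of_distTriang hT isCompactObj_intObj isCompactObj_intObj

lemma small_cyclicObj_hom {n : ℕ} (hn : n ≠ 0) (X : DerivedCategory AddCommGrpCat.{u}) :
    Small.{u} (cyclicObj.{u, w} n ⟶ X) := by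
  obtain ⟨f, g, h, hT⟩ := exists_int_distTriang.{u, w} hn
  exact small_hom_of_distTriang hT small_intObj_hom small_intObj_hom X

/-- Ext^i(ℤ/n, M) lies between Hom(ℤ, M[i - 1]) and Hom(ℤ, M[i]), and both vanish since i - 1 ≠ 0
and i ≠ 0. -/
lemma cyclicObj_hom_eq_zero {n : ℕ} (hn : n ≠ 0) {i : ℤ} (hi : 1 < i) (M : AddCommGrpCat.{u})
    (f : cyclicObj.{u, w} n ⟶
      ((DerivedCategory.singleFunctor AddCommGrpCat.{u} 0).obj M)⟦i⟧) : f = 0 := by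
  obtain ⟨a, b, c, hT⟩ := exists_int_distTriang.{u, w} hn
  obtain ⟨g, rfl⟩ : ∃ g : intObj.{u, w}⟦(1 : ℤ)⟧ ⟶ _, f = c ≫ g :=
    Triangle.yoneda_exact₃ _ hT f (intObj_hom_eq_zero (by lia) M (b ≫ f))
  have : g = 0 := (hom_shift_eq_zero_iff (show (1 : ℤ) + -1 = 0 by simp) _ _).2
    (hom_eq_zero_of_iso' ((shiftFunctorAdd' _ i (-1) (i - 1) (by lia)).symm.app _)
      (intObj_hom_eq_zero (show i - 1 ≠ 0 by lia) M)) g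
  rw [this, comp_zero]

/-- `ℤ/p^N` is an iterated extension of copies of `ℤ/p`. -/
lemma bigExtensionClosure_cyclicObj {p : ℕ} (hp : p ≠ 0) (N : ℕ) :
    bigExtensionClosure.{u} (shifts (ObjectProperty.singleton (cyclicObj.{u, w} p)) {0})
      (cyclicObj.{u, w} (p ^ N)) := by
  induction N with
  | zero =>
    refine .of_isZero ((DerivedCategory.singleFunctor AddCommGrpCat.{u} 0).map_isZero ?_)
    rw [pow_zero]
    exact AddCommGrpCat.isZero_of_subsingleton _
  | succ N ih =>
    -- The sequence ℤ/p → ℤ/p^{N+1} → ℤ/p^N, where `p ^ (N + 1)` unfolds to `p ^ N * p`.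
    obtain ⟨δ, hδ⟩ := exists_distTriang_of_exact.{u, w} (cyclicMul p (p ^ N))
      (ZMod.castHom (dvd_mul_right (p ^ N) p) (ZMod (p ^ N))).toAddMonoidHom
      (cyclicMul_injective p (pow_ne_zero N hp)) (ZMod.castHom_surjective (dvd_mul_right (p ^ N) p))
      (exact_cyclicMul_castHom p (p ^ N))
    exact .of_extension _ hδ (.of_mem (shifts_singleton_iff.2
      ⟨0, rfl, ⟨((shiftFunctorZero _ ℤ).app _).symm⟩⟩)) ih

end CyclicObjects

/-! ### Passage between a category and a localizing subcategory. -/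

section Localizing

variable {C : Type w'} [Category.{v'} C]

/-- The inclusion of a full subcategory reflects coproducts. -/
lemma isColimit_of_isColimit_ι {P : ObjectProperty C} {ι : Type t} {F : ι → P.FullSubcategory}
    {c : Cofan F} (hc : IsColimit (Cofan.mk c.pt.obj fun i => (c.inj i).hom)) :
    Nonempty (IsColimit c) :=
  ⟨isColimitOfReflects P.ι ((isColimitMapCoconeCofanMkEquiv P.ι F c.inj).symm hc)⟩

variable [Preadditive C] [HasShift C ℤ]
  [∀ n : ℤ, (shiftFunctor C n).Additive] [HasZeroObject C] [Pretriangulated C] {G : C}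

lemma localizing_of_isColimit {ι : Type u} {F : ι → C} {c : Cofan F} (hc : IsColimit c)
    (hF : ∀ i, localizing.{u} G (F i)) : localizing.{u} G c.pt :=
  .of_coproduct F c ⟨hc⟩ hF

/-- Coproducts in a localizing subcategory. -/
def localizingCofan [HasCoproducts.{u} C] {ι : Type u}
    (F : ι → (localizing.{u} G).FullSubcategory) : Cofan F :=
  Cofan.mk ⟨∐ fun i => (F i).obj,
    localizing_of_isColimit (coproductIsCoproduct _) fun i => (F i).property⟩
      fun i => ObjectProperty.homMk (Sigma.ι (fun i => (F i).obj) i)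

lemma isColimit_localizingCofan [HasCoproducts.{u} C] {ι : Type u}
    (F : ι → (localizing.{u} G).FullSubcategory) : Nonempty (IsColimit (localizingCofan F)) :=
  isColimit_of_isColimit_ι (c := localizingCofan F) (coproductIsCoproduct fun i => (F i).obj)

variable (G) in
lemma hasCoproducts_localizing [HasCoproducts.{u} C] :
    HasCoproducts.{u} (localizing.{u} G).FullSubcategory := by
  intro ι
  have : ∀ F : ι → (localizing.{u} G).FullSubcategory, HasCoproduct F := fun F =>
    ⟨_, (isColimit_localizingCofan F).some⟩
  exact ⟨fun F => have := this fun i => F.obj ⟨i⟩; hasColimit_of_iso Discrete.natIsoFunctor⟩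

/-- The inclusion of a localizing subcategory preserves coproducts. -/
lemma isColimit_ι_of_isColimit [HasCoproducts.{u} C] {ι : Type u}
    {F : ι → (localizing.{u} G).FullSubcategory} {c : Cofan F} (hc : IsColimit c) :
    Nonempty (IsColimit (Cofan.mk c.pt.obj fun i => (c.inj i).hom)) := by
  let c' := localizingCofan F
  have hc' : IsColimit c' := (isColimit_localizingCofan F).some
  let e : c'.pt ≅ c.pt := hc'.coconePointUniqueUpToIso hc
  have he : ∀ i, c'.inj i ≫ e.hom = c.inj i := fun i =>
    hc'.comp_coconePointUniqueUpToIso_hom hc ⟨i⟩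
  exact ⟨IsColimit.ofIsoColimit (coproductIsCoproduct fun i => (F i).obj)
    (Cofan.ext ((localizing.{u} G).ι.mapIso e) fun i => congrArg InducedCategory.Hom.hom (he i))⟩

lemma IsCompactObj.localizing [HasCoproducts.{u} C] {K : (localizing.{u} G).FullSubcategory}
    (hK : IsCompactObj.{u} K.obj) : IsCompactObj.{u} K := by
  refine isCompactObj_of_exists_sum fun {ι} F c hc f => ?_
  obtain ⟨s, g, hg⟩ : ∃ (s : Finset ι) (g : ∀ i, K.obj ⟶ (F i).obj),
      f.hom = ∑ i ∈ s, g i ≫ (c.inj i).hom :=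
    hK.exists_sum (isColimit_ι_of_isColimit hc).some f.hom
  refine ⟨s, fun i => ObjectProperty.homMk (g i), ?_⟩
  apply (Approximability.localizing.{u} G).ι.map_injective
  rw [Functor.map_sum]
  exact hg

/-- The extension-closure of a class of shifts of `G` is the same in `C` and in the localizing
subcategory generated by `G`. -/
lemma bigExtensionClosure_localizing {S : Set ℤ} {X : C}
    (hX : bigExtensionClosure.{u} (shifts (ObjectProperty.singleton G) S) X)
    (h : localizing.{u} G X) :
    bigExtensionClosure.{u} (shifts (ObjectProperty.singleton
      (⟨G, localizing_self G⟩ : (localizing.{u} G).FullSubcategory)) S) ⟨X, h⟩ := by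
  -- All intermediate objects of the construction lie in the subcategory, so the construction can be
  -- repeated there.
  have hS : ∀ {X : C}, bigExtensionClosure.{u} (shifts (ObjectProperty.singleton G) S) X →
      localizing.{u} G X := fun hX => hX.mono fun _ =>
    shifts_singleton_mono (Set.subset_univ S)
  induction hX with
  | of_mem hX =>
    obtain ⟨i, hi, ⟨e⟩⟩ := shifts_singleton_iff.1 hX
    exact .of_mem (shifts_singleton_iff.2 ⟨i, hi, ⟨(localizing.{u} G).ι.preimageIso
      (e ≪≫ (((localizing.{u} G).ι.commShiftIso i).app ⟨G, localizing_self G⟩).symm)⟩⟩)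
  | of_isZero hX => exact .of_isZero (by
      rw [IsZero.iff_id_eq_zero]
      apply (localizing.{u} G).ι.map_injective
      exact hX.eq_of_src _ _)
  | of_extension T hT h1 h3 ih1 ih3 =>
    let X₁ : (localizing.{u} G).FullSubcategory := ⟨T.obj₁, hS h1⟩
    let X₂ : (localizing.{u} G).FullSubcategory := ⟨T.obj₂, h⟩
    let X₃ : (localizing.{u} G).FullSubcategory := ⟨T.obj₃, hS h3⟩
    let T' : Triangle (localizing.{u} G).FullSubcategory :=
      Triangle.mk (X := X₁) (Y := X₂) (Z := X₃) (ObjectProperty.homMk T.mor₁)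
        (ObjectProperty.homMk T.mor₂) (ObjectProperty.homMk (T.mor₃ ≫
          ((localizing.{u} G).ι.commShiftIso (1 : ℤ)).inv.app X₁))
    refine .of_extension T' ?_ (ih1 _) (ih3 _)
    rw [← (localizing.{u} G).ι.map_distinguished_iff]
    refine isomorphic_distinguished _ hT _ (Triangle.isoMk _ _ (Iso.refl _) (Iso.refl _)
      (Iso.refl _) ?_ ?_ ?_)
    · exact (Category.comp_id _).trans (Category.id_comp _).symm
    · exact (Category.comp_id _).trans (Category.id_comp _).symm
    · change ((T.mor₃ ≫ ((localizing.{u} G).ι.commShiftIso (1 : ℤ)).inv.app X₁) ≫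
        ((localizing.{u} G).ι.commShiftIso (1 : ℤ)).hom.app X₁) ≫ (𝟙 T.obj₁)⟦(1 : ℤ)⟧' =
          𝟙 _ ≫ T.mor₃
      have h1 : ((localizing.{u} G).ι.commShiftIso (1 : ℤ)).inv.app X₁ ≫
          ((localizing.{u} G).ι.commShiftIso (1 : ℤ)).hom.app X₁ = 𝟙 _ :=
        Iso.inv_hom_id_app _ _
      have h2 : (𝟙 T.obj₁)⟦(1 : ℤ)⟧' = 𝟙 (T.obj₁⟦(1 : ℤ)⟧) := CategoryTheory.Functor.map_id _ _
      rw [h2, Category.id_comp]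
      refine (Category.comp_id _).trans ((Category.assoc _ _ _).trans ?_)
      exact (congrArg (T.mor₃ ≫ ·) h1).trans (Category.comp_id _)
  | of_coproduct F c hc hF ih =>
    obtain ⟨hc⟩ := hc
    let F' : _ → (localizing.{u} G).FullSubcategory := fun i => ⟨F i, hS (hF i)⟩
    exact .of_coproduct F' (Cofan.mk (⟨c.pt, h⟩ : (localizing.{u} G).FullSubcategory)
      fun i => ObjectProperty.homMk (c.inj i))
        (isColimit_of_isColimit_ι (IsColimit.ofIsoColimit hc (Cofan.ext (Iso.refl _) fun i =>
          Category.comp_id _))) fun i => ih i _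

lemma bigExtensionClosure.obj_of_localizing [HasCoproducts.{u} C] {S : Set ℤ}
    {X : (localizing.{u} G).FullSubcategory}
    (hX : bigExtensionClosure.{u} (shifts (ObjectProperty.singleton
      (⟨G, localizing_self G⟩ : (localizing.{u} G).FullSubcategory)) S) X) :
    bigExtensionClosure.{u} (shifts (ObjectProperty.singleton G) S) X.obj := by
  induction hX with
  | of_mem hX =>
    obtain ⟨i, hi, ⟨e⟩⟩ := shifts_singleton_iff.1 hX
    exact .of_mem (shifts_singleton_iff.2 ⟨i, hi, ⟨(localizing.{u} G).ι.mapIso e ≪≫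
      ((localizing.{u} G).ι.commShiftIso i).app ⟨G, localizing_self G⟩⟩⟩)
  | of_isZero hX => exact .of_isZero ((localizing.{u} G).ι.map_isZero hX)
  | of_extension T hT _ _ ih1 ih3 =>
    exact .of_extension _ ((localizing.{u} G).ι.map_distinguished T hT) ih1 ih3
  | of_coproduct F c hc _ ih =>
    exact .of_coproduct _ _ (isColimit_ι_of_isColimit hc.some) ih

theorem compactlyGenerates_localizing [HasCoproducts.{u} C] (hG : IsCompactObj.{u} G) :
    CompactlyGenerates.{u} (ObjectProperty.singleton
      (⟨G, localizing_self G⟩ : (localizing.{u} G).FullSubcategory)) := by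
  refine ⟨fun X hX => ?_, fun X => bigExtensionClosure_localizing X.property X.property⟩
  obtain rfl : (⟨G, localizing_self G⟩ : (localizing.{u} G).FullSubcategory) = X := by
    simpa using hX
  exact IsCompactObj.localizing hG

lemma isWeaklyNegative_localizing (hG : ∀ i : ℤ, 1 < i → ∀ f : G ⟶ G⟦i⟧, f = 0) :
    IsWeaklyNegative (ObjectProperty.singleton
      (⟨G, localizing_self G⟩ : (localizing.{u} G).FullSubcategory)) := by
  intro X Y hX hY i hi f
  obtain rfl : (⟨G, localizing_self G⟩ : (localizing.{u} G).FullSubcategory) = X := by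
    simpa using hX
  obtain rfl : (⟨G, localizing_self G⟩ : (localizing.{u} G).FullSubcategory) = Y := by
    simpa using hY
  apply (localizing.{u} G).ι.map_injective
  rw [Functor.map_zero]
  exact hom_eq_zero_of_iso' (((localizing.{u} G).ι.commShiftIso i).app ⟨G, localizing_self G⟩)
    (hG i hi) _

lemma small_localizing_hom {X : (localizing.{u} G).FullSubcategory}
    (h : ∀ Y : C, Small.{u} (X.obj ⟶ Y)) (Y : (localizing.{u} G).FullSubcategory) :
    Small.{u} (X ⟶ Y) :=
  have := h Y.obj
  small_of_injective (β := (X.obj ⟶ Y.obj)) (f := fun f => f.hom)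
    fun _ _ h => ObjectProperty.hom_ext _ h

end Localizing

/-! ### The objects ℤ/p^N of the subcategory generated by ℤ/p. -/

section Torsion

variable [HasDerivedCategory.{w} AddCommGrpCat.{u}] {p : ℕ}

/-- The object `ℤ/p^N` of `TorsionCat p`. -/
abbrev torsionObj (hp : p ≠ 0) (N : ℕ) : TorsionCat.{u, w} p :=
  ⟨cyclicObj (p ^ N), (bigExtensionClosure_cyclicObj hp N).mono fun _ =>
    shifts_singleton_mono (Set.subset_univ _)⟩

lemma bigExtensionClosure_torsionObj (hp : p ≠ 0) (N : ℕ) :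
    bigExtensionClosure.{u} (shifts (ObjectProperty.singleton (torsionGen.{u, w} p)) {0})
      (torsionObj.{u, w} hp N) :=
  bigExtensionClosure_localizing (bigExtensionClosure_cyclicObj hp N) _

lemma nsmul_id_torsionGen (p : ℕ) : p • 𝟙 (torsionGen.{u, w} p) = 0 := by
  apply (localizing.{u} (cyclicObj.{u, w} p)).ι.map_injective
  rw [Functor.map_nsmul, Functor.map_zero]
  exact nsmul_id_cyclicObj p

lemma pow_dvd_of_nsmul_id_torsionObj (hp : p ≠ 0) {N q : ℕ}
    (h : q • 𝟙 (torsionObj.{u, w} hp N) = 0) : p ^ N ∣ q := by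
  have h' : q • 𝟙 (torsionObj.{u, w} hp N).obj = 0 := congrArg InducedCategory.Hom.hom h
  exact dvd_of_nsmul_intToCyclic.{u, w} (nsmul_eq_zero_of_nsmul_id' h' _)

/-- `D` is built from `G[i]` with i ≥ 1, which have no cohomology in degree 0. -/
lemma intObj_hom_eq_zero_of_torsionAisle {D : TorsionCat.{u, w} p}
    (hD : torsionAisle.{u, w} p (D⟦(-1 : ℤ)⟧)) (f : intObj.{u, w} ⟶ D.obj) : f = 0 := by
  have h1 : bigExtensionClosure.{u} (shifts (ObjectProperty.singleton (torsionGen.{u, w} p))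
      (Set.Ici 1)) D :=
    bigExtensionClosure_of_iso _ ((shiftFunctorCompIsoId _ (-1 : ℤ) 1 (by simp)).app D)
      (bigExtensionClosure.shift (n := 1) (fun _ => shifts_singleton_shift
        fun i (hi : 0 ≤ i) => show 1 ≤ i + 1 by lia) hD)
  refine isCompactObj_intObj.hom_eq_zero (fun X hX => ?_) h1.obj_of_localizing f
  obtain ⟨i, hi, ⟨e⟩⟩ := shifts_singleton_iff.1 hX
  have hi' : 1 ≤ i := hi
  exact hom_eq_zero_of_iso' e (intObj_hom_eq_zero (by lia) _)

/-- The morphism ℤ → ℤ/p^{A+1} vanishes in `D`, so it lifts to `E` and is killed by p^A. The lift is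
made in D(Ab), where ℤ lives. -/
lemma not_hasApproximation_torsionObj (hp : p.Prime) (A : ℕ) (a b : ℤ) :
    ¬ HasApproximation (generatedIn.{u} (torsionGen.{u, w} p) A a b)
      (fun D => torsionAisle.{u, w} p (D⟦(-1 : ℤ)⟧)) (torsionObj.{u, w} hp.ne_zero (A + 1)) := by
  rintro ⟨E, D, f, g, δ, hT, hE, hD⟩
  obtain ⟨h, hh⟩ : ∃ h : intObj.{u, w} ⟶ E.obj, intToCyclic.{u, w} (p ^ (A + 1)) = h ≫ f.hom :=
    Triangle.coyoneda_exact₂ _ ((localizing.{u} (cyclicObj.{u, w} p)).ι.map_distinguished _ hT) _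
      (intObj_hom_eq_zero_of_torsionAisle hD _)
  have hE' : (p ^ A) • 𝟙 E.obj = 0 :=
    congrArg InducedCategory.Hom.hom (generatedIn.nsmul_id (nsmul_id_torsionGen.{u, w} p) hE)
  have h0 : (p ^ A) • intToCyclic.{u, w} (p ^ (A + 1)) = 0 := by
    rw [hh, ← Preadditive.nsmul_comp, nsmul_eq_zero_of_nsmul_id' hE', zero_comp]
  have := (Nat.pow_dvd_pow_iff_le_right hp.one_lt).1 (dvd_of_nsmul_intToCyclic h0)
  lia

end Torsion

end

end Approximability

theorem mainTheorem3 [HasDerivedCategory.{w} AddCommGrpCat.{u}] (p : ℕ) (hp : p.Prime) :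
    HasCoproducts.{u} (Approximability.TorsionCat.{u, w} p) ∧
    Approximability.CompactlyGenerates.{u}
      (ObjectProperty.singleton (Approximability.torsionGen.{u, w} p)) ∧
    Approximability.IsWeaklyNegative
      (ObjectProperty.singleton (Approximability.torsionGen.{u, w} p)) ∧
    Approximability.IsWeaklyApproximable.{u} (Approximability.TorsionCat.{u, w} p) ∧
    ¬ Approximability.IsApproximable.{u} (Approximability.TorsionCat.{u, w} p) ∧
    ∀ A : ℕ, 0 < A →
      (∀ E : Approximability.TorsionCat.{u, w} p,
        Approximability.generatedIn.{u} (Approximability.torsionGen.{u, w} p) A (-A) A E →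
          (p ^ A) • 𝟙 E = 0) ∧
      ∃ F : Approximability.TorsionCat.{u, w} p,
        Nonempty (F.obj ≅ Approximability.cyclicObj.{u, w} (p ^ (A + 1))) ∧
        Approximability.torsionAisle.{u, w} p F ∧
        ¬ Approximability.HasApproximation
          (Approximability.generatedIn.{u} (Approximability.torsionGen.{u, w} p) A (-A) A)
          (fun D => Approximability.torsionAisle.{u, w} p (D⟦(-1 : ℤ)⟧)) F := by
  have hp0 := hp.ne_zero
  have hcoprod := Approximability.hasCoproducts_localizing.{u} (Approximability.cyclicObj.{u, w} p)
  have hgen := Approximability.compactlyGenerates_localizing.{u}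
    (Approximability.isCompactObj_cyclicObj.{u, w} hp0)
  have hneg := Approximability.isWeaklyNegative_localizing.{u}
    (G := Approximability.cyclicObj.{u, w} p)
    fun i hi => Approximability.cyclicObj_hom_eq_zero hp0 hi _
  have hsmall : ∀ (i : ℤ) (X : Approximability.TorsionCat.{u, w} p),
      Small.{u} ((Approximability.torsionGen.{u, w} p)⟦i⟧ ⟶ X) := fun i X =>
    Approximability.small_hom_shift (Approximability.small_localizing_hom
      (Approximability.small_cyclicObj_hom.{u, w} hp0)) i X
  refine ⟨hcoprod, hgen, hneg,
    Approximability.isWeaklyApproximable_of_isWeaklyNegative hgen hneg hsmall,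
    Approximability.not_isApproximable hgen hneg hsmall
      (Approximability.nsmul_id_torsionGen p) fun N =>
        -- The exponent N + 1 is taken because p^{N+1} does not divide p^N.
        ⟨Approximability.torsionObj hp0 (N + 1),
          Approximability.bigExtensionClosure_torsionObj hp0 (N + 1), fun h => ?_⟩,
    fun A _ => ⟨fun E hE => hE.nsmul_id (Approximability.nsmul_id_torsionGen p),
      Approximability.torsionObj hp0 (A + 1), ⟨Iso.refl _⟩,
      (Approximability.bigExtensionClosure_torsionObj hp0 (A + 1)).mono fun _ =>
        Approximability.shifts_singleton_mono (by simp),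
      Approximability.not_hasApproximation_torsionObj hp A _ _⟩⟩
  have := (Nat.pow_dvd_pow_iff_le_right hp.one_lt).1
    (Approximability.pow_dvd_of_nsmul_id_torsionObj hp0 h)
  lia
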